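/- Let $\mathrm{poly}_{<1}$ denote the class of functions $p(x)=\sum_{i=1}^m c_i x^{a_i}$ on $[0,\infty)$ with $c_i\in\mathbb R$, real exponents $a_i\in(0,1)$, and $p(x)\to 0$ as $x\to 0$. **Setting.** Let $V=[n]$ and let $\mathcal E_1,\dots,\mathcal E_k$ be nonnegative weight functions on the edges $\binom{V}{2}$, each of total weight $1$; let $c_1,\dots,c_k\in\mathbb R$ be targets and $\epsilon\in(0,\tfrac15]$. Let $S\subseteq V$, $h:S\to\{0,1\}$, and $\mathcal L\subseteq[k]$ be arbitrary (in particular, $S$ may be the set of preselected vertices of the simultaneous Max-Cut algorithm and $\mathcal L$ its set of low-variance instances). An edge is *active* if at least one of its endpoints lies outside $S$. Put $\mathrm{actdeg}(\ell)=\sum_{v\in V\setminus S}\ \sum_{e\ni v,\ e\text{ active}}\mathcal E_\ell(e)$, and let $\mathrm{actdist}(\ell)$ be the distribution on active edges proportional to $\mathcal E_\ell$. **Lasserre solution.** For $r\ge 2$, an $r$-round Lasserre solution is a family of vectors $v_{T,\alpha}\in\mathbb R^d$ ($T\subseteq V$, $|T|\le r$, $\alpha\in\{0,1\}^T$; $d$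 is arbitrary) such that * $\langle v_{T,\alpha},v_{U,\beta}\rangle=\|v_{T\cup U,\alpha\circ\beta}\|^2$ if $|T\cup U|\le r$ and $\alpha,\beta$ agree on $T\cap U$ (where $\alpha\circ\beta$ is their common extension), and $\langle v_{T,\alpha},v_{U,\beta}\rangle=0$ if $|T\cup U|\le r$ and they disagree; * $\|v_{T,\alpha}\|^2=\langle v_{T,\alpha},v_\emptyset\rangle$ for $|T|\le r$, $\|v_\emptyset\|^2=1$, and $\sum_{\alpha}\|v_{T,\alpha}\|^2=1$ for all $|T|\le r$; * $\langle v_{T,\alpha},v_{i,h(i)}\rangle=\langle v_{T,\alpha},v_\emptyset\rangle$ for $|T|\le r-1$, $i\in S$; * for all $|T|\le r-2$ and all $\alpha$, $$\sum_{e=\{i,j\}}\mathcal E_\ell(e)\,q_{T,\alpha}(i,j)\ \ge\ (1-3\epsilon)\,c_\ell\,\|v_{T,\alpha}\|^2\quad(\ell\in[k]),$$ $$\sum_{e=\{i,j\}\text{ active}}\mathcal E_\ell(e)\,q_{T,\alpha}(i,j)\ \ge\ \tfrac{\epsilon}{3}\,\mathrm{actdeg}(\ell)\,\|v_{T,\alpha}\|^2\quad(\ell\in\mathcal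 L),$$ where $q_{T,\alpha}(i,j)=\|v_{T\cup\{i,j\},\alpha\circ(0,1)}\|^2+\|v_{T\cup\{i,j\},\alpha\circ(1,0)}\|^2$, only extensions consistent with $\alpha$ being counted. The numbers $\|v_{T,\alpha}\|^2=\Pr[X_T=\alpha]$ are the local distributions of $(X_i)_{i\in T}$. The solution is *$\delta$-independent* if for all $\ell\in\mathcal L$ $$\mathop{\mathbf E}_{a,b\sim\mathrm{actdist}(\ell)\text{ independent}}\Big[\sum_{i,j\in\{1,2\}}I(X_{a_i};X_{b_j})\Big]\le\delta ,$$ where $a_1,a_2$ are the endpoints of the edge $a$ and $I$ is mutual information in the local distribution of the pair. (The condition is void for an $\ell$ all of whose active edges have weight $0$.) **Rounding.** Let $f_R(x)=0.79x+0.07x^3+0.14x^7$, $\mu_i=2\mathbf E[X_i]-1$, $v_i=v_{i,1}-v_{i,0}$, $w_i$ the component of $v_i$ orthogonal to $v_\emptyset$, and $\overline w_i=w_i/\|w_i\|$ ($\overline w_i=0$ if $w_i=0$). Let $g$ be a standard Gaussian vector in the orthogonal complement of $v_\emptyset$. For $i\notin S$ assign to $i$ the value $1$ if $\langle g,\overline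 w_i\rangle\le\Phi^{-1}\big(\tfrac{f_R(\mu_i)}2+\tfrac12\big)$ and the value $0$ otherwise, where $\Phi^{-1}:[0,1]\to[-\infty,\infty]$ is the inverse Gaussian distribution function; for $i\in S$ assign $h(i)$. Let $Y_\ell$ be the total $\mathcal E_\ell$-weight of the active edges cut by this assignment. **Claim.** There is an absolute function $p\in\mathrm{poly}_{<1}$ (the same for all $n,k,r,d,\epsilon,\delta$ and all data above) such that for every $\delta\ge0$, every $r\ge2$ and every $\delta$-independent $r$-round Lasserre solution, $$\operatorname{Var}(Y_\ell)\ \le\ \frac{p(\delta)}{\epsilon^2}\,\mathbf E[Y_\ell]^2\qquad\text{for all }\ell\in\mathcal L .$$ -/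

import Mathlib

open MeasureTheory ProbabilityTheory Filter Topology
open scoped RealInnerProductSpace

noncomputable section

namespace SimMaxCut

/-- `p(x) = ∑ i, c i * x ^ a i` on `[0, ∞)` with finitely many real exponents `a i ∈ (0,1)`,
and `p(x) → 0` as `x → 0`. -/
def IsPolyLTOne (p : ℝ → ℝ) : Prop :=
  (∃ (m : ℕ) (c a : Fin m → ℝ), (∀ i, 0 < a i ∧ a i < 1) ∧
    ∀ x : ℝ, 0 ≤ x → p x = ∑ i, c i * x ^ a i) ∧
  Tendsto p (𝓝[>] 0) (𝓝 0)

/-! ### Weighted graphs on `[n]` -/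

/-- All potential edges on the vertex set `Fin n`; the edge `{i, j}` is the pair `(i, j)` with
`i < j`, and its two endpoints are `e.1` and `e.2`. -/
def edges (n : ℕ) : Finset (Fin n × Fin n) :=
  Finset.univ.filter fun e => e.1 < e.2

/-- A Max-Cut instance: nonnegative edge weights of total weight one. Only the values of `weight`
on `edges n` matter. -/
structure Instance (n : ℕ) where
  weight : Fin n × Fin n → ℝ
  nonneg : ∀ e ∈ edges n, 0 ≤ weight e
  total : ∑ e ∈ edges n, weight e = 1

variable {n : ℕ}

/-- Edges with at least one endpoint outside `S`. -/
def active (S : Finset (Fin n)) : Finset (Fin n × Fin n) :=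
  (edges n).filter fun e => e.1 ∉ S ∨ e.2 ∉ S

/-- The total weight of the active edges. -/
def activeWeight (S : Finset (Fin n)) (E : Instance n) : ℝ :=
  ∑ e ∈ active S, E.weight e

/-- The active degree of the vertex `v`. -/
def actdegVertex (S : Finset (Fin n)) (E : Instance n) (v : Fin n) : ℝ :=
  ∑ e ∈ (active S).filter (fun e => e.1 = v ∨ e.2 = v), E.weight e

/-- The active degree of the whole instance. -/
def actdeg (S : Finset (Fin n)) (E : Instance n) : ℝ :=
  ∑ v ∈ Sᶜ, actdegVertex S E v

/-- The probability of the edge `e` under the distribution on active edges obtained by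
renormalizing the weights to have total weight one on the active edges. If all active edges have
weight zero, there is no such distribution and the value here is zero. -/
def actdist (S : Finset (Fin n)) (E : Instance n) (e : Fin n × Fin n) : ℝ :=
  if e ∈ active S then E.weight e / activeWeight S E else 0

/-! ### Lasserre solutions -/

/-- A family of vectors `v_{T,α}` indexed by sets `T` of vertices and assignments
`α : T → {0,1}` (`false` is `0` and `true` is `1`). -/
abbrev VectorFamily (n d : ℕ) : Type :=
  (T : Finset (Fin n)) → (T → Bool) → EuclideanSpace ℝ (Fin d)

variable {d : ℕ}

namespace VectorFamily

/-- The vector `v_∅`. -/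
def empty (v : VectorFamily n d) : EuclideanSpace ℝ (Fin d) := v ∅ fun _ => false

/-- The vector `v_{i,b}`. -/
def single (v : VectorFamily n d) (i : Fin n) (b : Bool) : EuclideanSpace ℝ (Fin d) :=
  v {i} fun _ => b

/-- `Pr[X_T = α]` in the local distribution on `T`. -/
def localProb (v : VectorFamily n d) (T : Finset (Fin n)) (α : T → Bool) : ℝ := ‖v T α‖ ^ 2

/-- `Pr[X_i = a, X_j = b]` in the local distribution on `{i, j}` (also for `i = j`). -/
def pairProb (v : VectorFamily n d) (i j : Fin n) (a b : Bool) : ℝ :=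
  ∑ γ : ({i, j} : Finset (Fin n)) → Bool,
    if γ ⟨i, by simp⟩ = a ∧ γ ⟨j, by simp⟩ = b then v.localProb {i, j} γ else 0

/-- `Pr[X_S = α and X_i ≠ X_j]` in the local distribution on `S ∪ {i, j}`, i.e.
`‖v_{S ∪ {i,j}, α ∘ (0,1)}‖² + ‖v_{S ∪ {i,j}, α ∘ (1,0)}‖²`, where only those extensions count
that are consistent with `α`. -/
def cutProb (v : VectorFamily n d) (S : Finset (Fin n)) (α : S → Bool) (i j : Fin n) : ℝ :=
  ∑ γ : (S ∪ {i, j} : Finset (Fin n)) → Bool,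
    if Finset.restrict₂ (π := fun _ => Bool) Finset.subset_union_left γ = α ∧
        γ ⟨i, by simp⟩ ≠ γ ⟨j, by simp⟩ then
      ‖v (S ∪ {i, j}) γ‖ ^ 2 else 0

end VectorFamily

/-- Feasible solutions of the `r`-round Lasserre relaxation of simultaneous Max-Cut on the
instances `E 1, …, E k` with targets `c`, with partial assignment `h` to the set `S`, where the
active-cut constraint is imposed for the instances in `L`. -/
structure IsLasserreSolution (r : ℕ) {k : ℕ} (ε : ℝ) (E : Fin k → Instance n) (c : Fin k → ℝ)
    (S : Finset (Fin n)) (h : S → Bool) (L : Finset (Fin k)) (v : VectorFamily n d) : Prop where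
  objective : ∀ (T : Finset (Fin n)) (α : T → Bool), T.card + 2 ≤ r → ∀ l : Fin k,
    (1 - 3 * ε) * c l * ‖v T α‖ ^ 2 ≤
      ∑ e ∈ edges n, (E l).weight e * v.cutProb T α e.1 e.2
  active_cut : ∀ (T : Finset (Fin n)) (α : T → Bool), T.card + 2 ≤ r → ∀ l ∈ L,
    ε / 3 * actdeg S (E l) * ‖v T α‖ ^ 2 ≤
      ∑ e ∈ active S, (E l).weight e * v.cutProb T α e.1 e.2
  /-- For consistent `α = γ|T` and `β = γ|U` one has `⟪v_{T,α}, v_{U,β}⟫ = ‖v_{T ∪ U, γ}‖²`. -/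
  consistent : ∀ (T U : Finset (Fin n)), (T ∪ U).card ≤ r →
    ∀ γ : (T ∪ U : Finset (Fin n)) → Bool,
      ⟪v T (Finset.restrict₂ (π := fun _ => Bool) Finset.subset_union_left γ),
        v U (Finset.restrict₂ (π := fun _ => Bool) Finset.subset_union_right γ)⟫ =
      ‖v (T ∪ U) γ‖ ^ 2
  inconsistent : ∀ (T U : Finset (Fin n)), (T ∪ U).card ≤ r →
    ∀ (α : T → Bool) (β : U → Bool),
      (∃ (i : Fin n) (hT : i ∈ T) (hU : i ∈ U), α ⟨i, hT⟩ ≠ β ⟨i, hU⟩) →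
      ⟪v T α, v U β⟫ = 0
  norm_sq : ∀ (T : Finset (Fin n)) (α : T → Bool), T.card ≤ r →
    ‖v T α‖ ^ 2 = ⟪v T α, v.empty⟫
  partial_fixing : ∀ (T : Finset (Fin n)) (α : T → Bool), T.card + 1 ≤ r →
    ∀ i : S, ⟪v T α, v.single i (h i)⟫ = ⟪v T α, v.empty⟫
  norm_empty : ‖v.empty‖ ^ 2 = 1
  /-- The numbers `‖v_{T,α}‖²` form a probability distribution on the assignments to `T`. -/
  total_prob : ∀ T : Finset (Fin n), T.card ≤ r → ∑ α : T → Bool, v.localProb T α = 1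

/-- The mutual information (in bits) of two random variables with joint probabilities `P`. -/
def mutualInfo (P : Bool → Bool → ℝ) : ℝ :=
  ∑ a, ∑ b, P a b * Real.logb 2 (P a b / ((∑ b', P a b') * ∑ a', P a' b))

/-- `∑_{i,j ∈ {1,2}} I(X_{a_i}; X_{b_j})` for two edges `a = (a_1,a_2)` and `b = (b_1,b_2)`. -/
def edgeInfo (v : VectorFamily n d) (a b : Fin n × Fin n) : ℝ :=
  mutualInfo (v.pairProb a.1 b.1) + mutualInfo (v.pairProb a.1 b.2) +
    mutualInfo (v.pairProb a.2 b.1) + mutualInfo (v.pairProb a.2 b.2)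

/-- `δ`-independence, for two edges sampled independently from the active distribution. -/
def IsIndependent {k : ℕ} (δ : ℝ) (E : Fin k → Instance n) (S : Finset (Fin n))
    (L : Finset (Fin k)) (v : VectorFamily n d) : Prop :=
  ∀ l ∈ L, ∑ a ∈ active S, ∑ b ∈ active S,
    actdist S (E l) a * actdist S (E l) b * edgeInfo v a b ≤ δ

/-! ### The rounding procedure -/

/-- The rounding function. -/
def fR (x : ℝ) : ℝ := 0.79 * x + 0.07 * x ^ 3 + 0.14 * x ^ 7

/-- The inverse `Φ⁻¹ : [0,1] → [-∞,∞]` of the cumulative distribution function of `N(0,1)`. -/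
def gaussianQuantile (p : ℝ) : EReal :=
  ⨆ x ∈ {x : ℝ | cdf (gaussianReal 0 1) x ≤ p}, (x : EReal)

namespace VectorFamily

/-- The bias `μ_i = 2 E[X_i] - 1` in the local distribution, where `E[X_i] = Pr[X_i = 1]`. -/
def bias (v : VectorFamily n d) (i : Fin n) : ℝ :=
  2 * v.localProb {i} (fun _ => true) - 1

/-- `v_i = v_{i,1} - v_{i,0}`. -/
def vec (v : VectorFamily n d) (i : Fin n) : EuclideanSpace ℝ (Fin d) :=
  v.single i true - v.single i false

/-- The component `w_i` of `v_i` orthogonal to the unit vector `v_∅`. -/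
def orthVec (v : VectorFamily n d) (i : Fin n) : EuclideanSpace ℝ (Fin d) :=
  v.vec i - ⟪v.empty, v.vec i⟫ • v.empty

/-- The normalization of `w_i` (zero if `w_i = 0`, in which case `μ_i = ±1` and the value of
`y_i` below does not depend on this choice). -/
def unitVec (v : VectorFamily n d) (i : Fin n) : EuclideanSpace ℝ (Fin d) :=
  ‖v.orthVec i‖⁻¹ • v.orthVec i

/-- The orthogonal complement of `v_∅`. -/
abbrev perp (v : VectorFamily n d) : Submodule ℝ (EuclideanSpace ℝ (Fin d)) :=
  (Submodule.span ℝ {v.empty})ᗮ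

/-- The law of the random Gaussian vector: the standard Gaussian on the orthogonal complement
of `v_∅`. -/
def gaussianLaw (v : VectorFamily n d) : Measure v.perp := stdGaussian v.perp

open Classical in
/-- The rounded value `y_i`, where `true` stands for `y_i = 1` and `false` for `y_i = -1`. -/
def rounded (v : VectorFamily n d) (g : v.perp) (i : Fin n) : Bool :=
  if ((⟪(g : EuclideanSpace ℝ (Fin d)), v.unitVec i⟫ : ℝ) : EReal) ≤
      gaussianQuantile (fR (v.bias i) / 2 + 1 / 2) then true else false

/-- The assignment `h ∪ g`: `h` on `S` and the rounded values outside `S`. -/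
def assignment (v : VectorFamily n d) {S : Finset (Fin n)} (h : S → Bool) (g : v.perp)
    (i : Fin n) : Bool :=
  if hi : i ∈ S then h ⟨i, hi⟩ else v.rounded g i

/-- `Y_ℓ`: the total weight of the active edges cut by `h ∪ g`, as a random variable in the
Gaussian vector. -/
def cutWeight (v : VectorFamily n d) (E : Instance n) {S : Finset (Fin n)} (h : S → Bool)
    (g : v.perp) : ℝ :=
  ∑ e ∈ active S,
    E.weight e * if v.assignment h g e.1 ≠ v.assignment h g e.2 then 1 else 0

end VectorFamily

end SimMaxCut

end

/-! Write `W` for the total active weight of an instance in `L`. The bound compares both sides with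
`W`: the mean of the cut weight is at least `ε * W / 36`, and its variance is at most `104 * x * W ^
2` for every `x > 0` with `δ ≤ x ^ 8`. Taking `x = δ ^ (1/8)` gives `p`.

Mean (`activeWeight_le_integral`). The active-cut constraint for `T = ∅` bounds the relaxation's
active cut value below by `ε / 3` times the active degree, which is at least `W`. Rounding loses
only a constant factor on each edge (`cutProb_le_measureReal_sepEvent`): an edge cut by the
relaxation has endpoints with different biases, which `fR` preserves up to a factor, or directions
at an angle, and two half-spaces at correlation `ρ` differ on mass of order `1 - ρ`
(`mul_min_le_measureReal_symmDiff`).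

Variance (`variance_cutWeight_le`). It is a weighted sum over pairs of edges of covariances of cut
indicators. Mutual information controls `⟪w_i, w_j⟫ ^ 2` through `sq_le_mutualInfo`, so
`δ`-independence makes these inner products small on average. Normalizing `w_i` could destroy this
when `w_i` is short; such vertices are nearly deterministic and are first replaced by constants
(`truncSet`). For the others, `abs_integral_bits_mul_sub_le` says that threshold events of two
weakly correlated Gaussian families are nearly independent. Noise of small variance turns the true
family and a decoupled copy into families with the same Gram matrix, hence the same law, and noise
seldom moves a Gaussian across a threshold.

Only the pairwise part of the Lasserre solution is used, so `2 ≤ r` suffices. -/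

noncomputable section

namespace SimMaxCut

/-! ### Standard Gaussian vectors: Gram matrices, independence, anti-concentration -/

section Gaussian

variable {E F : Type*} [NormedAddCommGroup E] [InnerProductSpace ℝ E] [FiniteDimensional ℝ E]
  [MeasurableSpace E] [BorelSpace E]
  [NormedAddCommGroup F] [InnerProductSpace ℝ F] [FiniteDimensional ℝ F]
  [MeasurableSpace F] [BorelSpace F]
  {ι κ : Type*} [Fintype ι] [Fintype κ]

/-- The joint law of Gaussian linear functionals depends only on their Gram matrix. -/
theorem map_inner_stdGaussian_eq {u : ι → E} {v : ι → F}
    (h : ∀ i j, ⟪u i, u j⟫ = ⟪v i, v j⟫) :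
    (stdGaussian E).map (fun x i => ⟪u i, x⟫) = (stdGaussian F).map (fun x i => ⟪v i, x⟫) := by
  have key : (stdGaussian E).map (fun x => WithLp.toLp 2 fun i => ⟪u i, x⟫) =
      (stdGaussian F).map (fun x => WithLp.toLp 2 fun i => ⟪v i, x⟫) := by
    have h1 : IsProbabilityMeasure
        ((stdGaussian E).map (fun x => WithLp.toLp 2 fun i => ⟪u i, x⟫)) :=
      Measure.isProbabilityMeasure_map (by fun_prop)
    have h2 : IsProbabilityMeasure
        ((stdGaussian F).map (fun x => WithLp.toLp 2 fun i => ⟪v i, x⟫)) :=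
      Measure.isProbabilityMeasure_map (by fun_prop)
    apply Measure.ext_of_charFun
    ext t
    have e1 : charFun ((stdGaussian E).map (fun x => WithLp.toLp 2 fun i => ⟪u i, x⟫)) t =
        charFun (stdGaussian E) (∑ i, t i • u i) := by
      rw [charFun_apply, charFun_apply, integral_map (by fun_prop) (by fun_prop)]
      congr 1; ext x
      simp [PiLp.inner_apply, inner_sum, inner_smul_right, real_inner_comm]
    have e2 : charFun ((stdGaussian F).map (fun x => WithLp.toLp 2 fun i => ⟪v i, x⟫)) t =
        charFun (stdGaussian F) (∑ i, t i • v i) := by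
      rw [charFun_apply, charFun_apply, integral_map (by fun_prop) (by fun_prop)]
      congr 1; ext x
      simp [PiLp.inner_apply, inner_sum, inner_smul_right, real_inner_comm]
    rw [e1, e2, charFun_stdGaussian, charFun_stdGaussian]
    have e3 : ‖∑ i, t i • u i‖ ^ 2 = ‖∑ i, t i • v i‖ ^ 2 := by
      rw [← real_inner_self_eq_norm_sq, ← real_inner_self_eq_norm_sq]
      simp only [sum_inner, inner_sum, real_inner_smul_left, real_inner_smul_right, h]
    norm_cast
    rw [e3]
  have := congrArg (fun μ => μ.map (WithLp.ofLp : EuclideanSpace ℝ ι → ι → ℝ)) key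
  simp only at this
  rw [Measure.map_map (by fun_prop) (by fun_prop), Measure.map_map (by fun_prop) (by fun_prop)]
    at this
  exact this

theorem integral_inner_stdGaussian_congr {u : ι → E} {v : ι → F}
    (h : ∀ i j, ⟪u i, u j⟫ = ⟪v i, v j⟫) {f : (ι → ℝ) → ℝ} (hf : Measurable f) :
    ∫ x, f (fun i => ⟪u i, x⟫) ∂stdGaussian E = ∫ x, f (fun i => ⟪v i, x⟫) ∂stdGaussian F := by
  rw [← integral_map (μ := stdGaussian E) (φ := fun x i => ⟪u i, x⟫) (f := f) (by fun_prop)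
    hf.aestronglyMeasurable, map_inner_stdGaussian_eq h,
    integral_map (by fun_prop) hf.aestronglyMeasurable]

theorem measureReal_inner_stdGaussian_congr {u : ι → E} {v : ι → F}
    (h : ∀ i j, ⟪u i, u j⟫ = ⟪v i, v j⟫) {s : Set (ι → ℝ)} (hs : MeasurableSet s) :
    (stdGaussian E).real {x | (fun i => ⟪u i, x⟫) ∈ s} =
      (stdGaussian F).real {x | (fun i => ⟪v i, x⟫) ∈ s} := by
  have := congrArg (fun μ => μ.real s) (map_inner_stdGaussian_eq h)
  rw [map_measureReal_apply (by fun_prop) hs, map_measureReal_apply (by fun_prop) hs] at this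
  exact this

theorem covariance_inner_stdGaussian (u v : E) :
    cov[fun x => ⟪u, x⟫, fun x => ⟪v, x⟫; stdGaussian E] = ⟪u, v⟫ := by
  rw [← covarianceBilin_apply_eq_cov IsGaussian.memLp_two_id, covarianceBilin_stdGaussian]
  rfl

/-- Functions of orthogonal families of Gaussian functionals are uncorrelated. -/
theorem integral_mul_stdGaussian_of_orthogonal {u : ι → E} {v : κ → E}
    (h : ∀ i j, ⟪u i, v j⟫ = 0) {f : (ι → ℝ) → ℝ} {g : (κ → ℝ) → ℝ}
    (hf : Measurable f) (hg : Measurable g) :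
    ∫ x, f (fun i => ⟪u i, x⟫) * g (fun i => ⟪v i, x⟫) ∂stdGaussian E =
      (∫ x, f (fun i => ⟪u i, x⟫) ∂stdGaussian E) *
        ∫ x, g (fun i => ⟪v i, x⟫) ∂stdGaussian E := by
  have hid : HasGaussianLaw (id : E → E) (stdGaussian E) := ⟨by rw [Measure.map_id]; infer_instance⟩
  let T : E →L[ℝ] (ι → ℝ) × (κ → ℝ) :=
    (ContinuousLinearMap.pi fun i => innerSL ℝ (u i)).prod
      (ContinuousLinearMap.pi fun i => innerSL ℝ (v i))
  have hT : HasGaussianLaw (fun x : E => ((fun i => ⟪u i, x⟫), fun i => ⟪v i, x⟫))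
      (stdGaussian E) := hid.map T
  have hind := HasGaussianLaw.indepFun_of_covariance_eval (X := fun i x => ⟪u i, x⟫)
    (Y := fun i x => ⟪v i, x⟫) hT (fun i j => by rw [covariance_inner_stdGaussian, h])
  exact (hind.comp hf hg).integral_fun_mul_eq_mul_integral
    (hf.comp (by fun_prop)).aestronglyMeasurable (hg.comp (by fun_prop)).aestronglyMeasurable

theorem map_inner_stdGaussian_of_norm_eq_one {u : E} (hu : ‖u‖ = 1) :
    (stdGaussian E).map (fun x => ⟪u, x⟫) = gaussianReal 0 1 := by
  have : IsProbabilityMeasure ((stdGaussian E).map (fun x => ⟪u, x⟫)) :=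
    Measure.isProbabilityMeasure_map (by fun_prop)
  apply Measure.ext_of_charFun
  ext t
  have e1 : charFun ((stdGaussian E).map (fun x => ⟪u, x⟫)) t =
      charFun (stdGaussian E) (t • u) := by
    rw [charFun_apply, charFun_apply, integral_map (by fun_prop) (by fun_prop)]
    congr 1; ext x
    simp [inner_smul_right, real_inner_comm]
  rw [e1, charFun_stdGaussian, charFun_gaussianReal, norm_smul, hu]
  simp [neg_div, ← Complex.ofReal_pow]

theorem measureReal_inner_mem_of_norm_eq_one {u : E} (hu : ‖u‖ = 1) {s : Set ℝ}
    (hs : MeasurableSet s) :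
    (stdGaussian E).real {x | ⟪u, x⟫ ∈ s} = (gaussianReal 0 1).real s := by
  rw [← map_inner_stdGaussian_of_norm_eq_one hu, map_measureReal_apply (by fun_prop) hs]
  rfl

/-- The density is at most `1`, since `2 * π ≥ 1`; the sharper constant is not needed. -/
theorem gaussianReal_real_Icc_le (a b : ℝ) (hab : a ≤ b) :
    (gaussianReal 0 1).real (Set.Icc a b) ≤ b - a := by
  rw [measureReal_def, gaussianReal_apply_eq_integral 0 one_ne_zero,
    ENNReal.toReal_ofReal (setIntegral_nonneg measurableSet_Icc
      fun x _ => gaussianPDFReal_nonneg _ _ _)]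
  calc ∫ x in Set.Icc a b, gaussianPDFReal 0 1 x ≤ ∫ x in Set.Icc a b, (1 : ℝ) := by
        apply setIntegral_mono_on (integrable_gaussianPDFReal 0 1).integrableOn
          (by simp) measurableSet_Icc
        intro x _
        rw [gaussianPDFReal]
        have h1 : 1 ≤ √(2 * Real.pi * (1 : NNReal)) := by
          rw [Real.one_le_sqrt]; push_cast; linarith [Real.pi_gt_three]
        have h2 : Real.exp (-(x - 0) ^ 2 / (2 * (1 : NNReal))) ≤ 1 := by
          rw [Real.exp_le_one_iff]; push_cast; nlinarith [sq_nonneg (x - 0)]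
        exact mul_le_one₀ (inv_le_one_of_one_le₀ h1) (Real.exp_pos _).le h2
    _ = b - a := by simp [hab]

end Gaussian

/-! ### Stability of threshold events under perturbation of the direction -/

section Stability

set_option linter.unusedSectionVars false

variable {E : Type*} [NormedAddCommGroup E] [InnerProductSpace ℝ E] [FiniteDimensional ℝ E]
  [MeasurableSpace E] [BorelSpace E]
  {ι κ : Type*} [Fintype ι] [Fintype κ]

theorem measureReal_le_abs_inner_le (w : E) {c : ℝ} (hc : 0 < c) :
    (stdGaussian E).real {x | c ≤ |⟪w, x⟫|} ≤ ‖w‖ ^ 2 / c ^ 2 := by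
  have hid : HasGaussianLaw (id : E → E) (stdGaussian E) := ⟨by
    rw [Measure.map_id]; infer_instance⟩
  have hL : HasGaussianLaw (fun x : E => ⟪w, x⟫) (stdGaussian E) := hid.map (innerSL ℝ w)
  have h0 : (∫ x, ⟪w, x⟫ ∂stdGaussian E) = 0 := integral_strongDual_stdGaussian (innerSL ℝ w)
  have h1 := meas_ge_le_variance_div_sq hL.memLp_two hc
  rw [← covariance_self hL.aemeasurable, covariance_inner_stdGaussian, h0,
    real_inner_self_eq_norm_sq] at h1
  simp only [sub_zero] at h1
  rw [measureReal_def]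
  exact ENNReal.toReal_le_of_le_ofReal (by positivity) h1

/-- `A` is empty, everything, or a closed lower half-line while `u` is a unit vector. -/
def IsThreshold (A : Set ℝ) (u : E) : Prop :=
  A = ∅ ∨ A = Set.univ ∨ ∃ t, A = Set.Iic t ∧ ‖u‖ = 1

theorem IsThreshold.measurableSet {A : Set ℝ} {u : E} (h : IsThreshold A u) :
    MeasurableSet A := by
  rcases h with rfl | rfl | ⟨t, rfl, -⟩
  · exact MeasurableSet.empty
  · exact MeasurableSet.univ
  · exact measurableSet_Iic

/-- If the two events disagree, either `⟪u, x⟫` lies within `c` of the threshold, which has mass at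
most `2 * c` because `u` is a unit vector, or `⟪u' - u, x⟫` is at least `c` in absolute value, which
Chebyshev bounds. The vector `u'` need not be normalized, so it may carry added noise. -/
theorem IsThreshold.measureReal_disagree_le {A : Set ℝ} {u : E} (hA : IsThreshold A u) (u' : E)
    {c : ℝ} (hc : 0 < c) :
    (stdGaussian E).real {x | ¬(⟪u, x⟫ ∈ A ↔ ⟪u', x⟫ ∈ A)} ≤ 2 * c + ‖u' - u‖ ^ 2 / c ^ 2 := by
  have hpos : 0 ≤ 2 * c + ‖u' - u‖ ^ 2 / c ^ 2 := by positivity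
  rcases hA with rfl | rfl | ⟨t, rfl, hu⟩
  · simpa using hpos
  · simpa using hpos
  have hsub : {x | ¬(⟪u, x⟫ ∈ Set.Iic t ↔ ⟪u', x⟫ ∈ Set.Iic t)} ⊆
      {x | ⟪u, x⟫ ∈ Set.Icc (t - c) (t + c)} ∪ {x | c ≤ |⟪u' - u, x⟫|} := by
    intro x hx
    simp only [Set.mem_ofPred_eq, Set.mem_Iic, Set.mem_union, Set.mem_Icc, inner_sub_left] at hx ⊢
    by_contra hcon
    rw [not_or, not_le, abs_lt] at hcon
    obtain ⟨h1, h2, h3⟩ := hcon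
    apply hx
    constructor
    · intro h; by_contra h'; apply h1; constructor <;> linarith
    · intro h; by_contra h'; apply h1; constructor <;> linarith
  calc _ ≤ _ := measureReal_mono hsub
    _ ≤ _ := measureReal_union_le _ _
    _ ≤ _ := by
      apply add_le_add
      · rw [measureReal_inner_mem_of_norm_eq_one hu measurableSet_Icc]
        refine (gaussianReal_real_Icc_le _ _ (by linarith)).trans (by linarith)
      · exact measureReal_le_abs_inner_le _ hc

open Classical in
/-- The indicator bits of the events `⟪u i, x⟫ ∈ A i`. -/
def bits (A : ι → Set ℝ) (y : ι → ℝ) (i : ι) : Bool := decide (y i ∈ A i)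

theorem measurable_bits {A : ι → Set ℝ} (hA : ∀ i, MeasurableSet (A i)) :
    Measurable (bits A) := by
  refine measurable_pi_lambda _ fun i => ?_
  refine measurable_to_bool ?_
  have : (fun y : ι → ℝ => bits A y i) ⁻¹' {true} = (fun y => y i) ⁻¹' A i := by
    ext y; simp [bits]
  rw [this]
  exact (measurable_pi_apply i) (hA i)

theorem abs_integral_bits_sub_le {u u' : ι → E} {A A' : ι → Set ℝ}
    (hA : ∀ i, MeasurableSet (A i)) (hA' : ∀ i, MeasurableSet (A' i))
    {f : (ι → Bool) → ℝ} (hf : ∀ b, f b ∈ Set.Icc (0 : ℝ) 1) :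
    |(∫ x, f (bits A fun i => ⟪u i, x⟫) ∂stdGaussian E) -
        ∫ x, f (bits A' fun i => ⟪u' i, x⟫) ∂stdGaussian E| ≤
      ∑ i, (stdGaussian E).real {x | ¬(⟪u i, x⟫ ∈ A i ↔ ⟪u' i, x⟫ ∈ A' i)} := by
  have hfm : Measurable f := measurable_of_finite f
  have m1 : Measurable fun x : E => f (bits A fun i => ⟪u i, x⟫) :=
    (hfm.comp (measurable_bits hA)).comp (g := f ∘ bits A) (by fun_prop)
  have m2 : Measurable fun x : E => f (bits A' fun i => ⟪u' i, x⟫) :=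
    (hfm.comp (measurable_bits hA')).comp (g := f ∘ bits A') (by fun_prop)
  have i1 : Integrable (fun x : E => f (bits A fun i => ⟪u i, x⟫)) (stdGaussian E) :=
    Integrable.of_bound m1.aestronglyMeasurable 1 (ae_of_all _ fun x => by
      rw [Real.norm_eq_abs, abs_le]; constructor <;> linarith [(hf (bits A fun i => ⟪u i, x⟫)).1,
        (hf (bits A fun i => ⟪u i, x⟫)).2])
  have i2 : Integrable (fun x : E => f (bits A' fun i => ⟪u' i, x⟫)) (stdGaussian E) :=
    Integrable.of_bound m2.aestronglyMeasurable 1 (ae_of_all _ fun x => by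
      rw [Real.norm_eq_abs, abs_le]; constructor <;> linarith [(hf (bits A' fun i => ⟪u' i, x⟫)).1,
        (hf (bits A' fun i => ⟪u' i, x⟫)).2])
  rw [← integral_sub i1 i2]
  set D : Set E := ⋃ i, {x | ¬(⟪u i, x⟫ ∈ A i ↔ ⟪u' i, x⟫ ∈ A' i)} with hD
  have hDm : MeasurableSet D := by
    refine MeasurableSet.iUnion fun i => ?_
    have a1 : MeasurableSet {x : E | ⟪u i, x⟫ ∈ A i} :=
      (show Measurable fun x : E => ⟪u i, x⟫ by fun_prop) (hA i)
    have a2 : MeasurableSet {x : E | ⟪u' i, x⟫ ∈ A' i} :=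
      (show Measurable fun x : E => ⟪u' i, x⟫ by fun_prop) (hA' i)
    exact MeasurableSet.compl (MeasurableSet.iff a1 a2)
  calc _ ≤ ∫ x, |f (bits A fun i => ⟪u i, x⟫) - f (bits A' fun i => ⟪u' i, x⟫)|
        ∂stdGaussian E := abs_integral_le_integral_abs
    _ ≤ ∫ x, D.indicator (fun _ => (1 : ℝ)) x ∂stdGaussian E := by
        refine integral_mono (i1.sub i2).abs ((integrable_const _).indicator hDm) fun x => ?_
        by_cases hx : x ∈ D
        · simp only [Set.indicator_of_mem hx]
          rw [abs_le]
          constructor <;> linarith [(hf (bits A fun i => ⟪u i, x⟫)).1,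
            (hf (bits A fun i => ⟪u i, x⟫)).2, (hf (bits A' fun i => ⟪u' i, x⟫)).1,
            (hf (bits A' fun i => ⟪u' i, x⟫)).2]
        · have : (bits A fun i => ⟪u i, x⟫) = bits A' fun i => ⟪u' i, x⟫ := by
            ext i
            simp only [hD, Set.mem_iUnion, Set.mem_ofPred_eq, not_exists, not_not] at hx
            simp [bits, hx i]
          simp [Set.indicator_of_notMem hx, this]
    _ = (stdGaussian E).real D := by
        rw [integral_indicator hDm]; simp
    _ ≤ _ := measureReal_iUnion_fintype_le _

end Stability

/-! ### Decoupling two weakly correlated Gaussian families -/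

section Decoupling

set_option linter.unusedSectionVars false

variable {E : Type*} [NormedAddCommGroup E] [InnerProductSpace ℝ E] [FiniteDimensional ℝ E]
  [MeasurableSpace E] [BorelSpace E]
  {ι κ : Type*} [Fintype ι] [Fintype κ] [DecidableEq ι] [DecidableEq κ]

/-- The total absolute correlation of one functional with those of the other family. -/
def crossSum (ρ : ι → κ → ℝ) : ι ⊕ κ → ℝ :=
  Sum.elim (fun i => ∑ j, |ρ i j|) (fun j => ∑ i, |ρ i j|)

theorem crossSum_nonneg (ρ : ι → κ → ℝ) (k : ι ⊕ κ) : 0 ≤ crossSum ρ k := by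
  rcases k with i | j <;> exact Finset.sum_nonneg fun _ _ => abs_nonneg _

theorem crossSum_le (ρ : ι → κ → ℝ) (k : ι ⊕ κ) : crossSum ρ k ≤ ∑ i, ∑ j, |ρ i j| := by
  rcases k with i | j
  · exact Finset.single_le_sum (f := fun i => ∑ j, |ρ i j|)
      (fun _ _ => Finset.sum_nonneg fun _ _ => abs_nonneg _) (Finset.mem_univ i)
  · exact Finset.sum_le_sum fun i _ => Finset.single_le_sum (f := fun j => |ρ i j|)
      (fun _ _ => abs_nonneg _) (Finset.mem_univ j)

/-- Orthogonal noise. -/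
def diagNoise (ρ : ι → κ → ℝ) (k : ι ⊕ κ) : EuclideanSpace ℝ (ι ⊕ κ) :=
  EuclideanSpace.single k (√(crossSum ρ k))

/-- Noise with the same variances as `diagNoise` and with cross-correlations `ρ`. -/
def crossNoise (ρ : ι → κ → ℝ) : ι ⊕ κ → EuclideanSpace ℝ (ι × κ) :=
  Sum.elim (fun i => WithLp.toLp 2 fun p => if p.1 = i then √|ρ p.1 p.2| else 0)
    (fun j => WithLp.toLp 2 fun p =>
      if p.2 = j then SignType.sign (ρ p.1 p.2) * √|ρ p.1 p.2| else 0)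

/-- This and `inner_crossNoise` show that the two noises have Gram matrices differing exactly by the
cross-correlations `ρ`. In `crossNoise` each pair `(i, j)` owns one coordinate, shared by `i` and
`j` only, with product of entries `ρ i j`. -/
theorem inner_diagNoise (ρ : ι → κ → ℝ) (k l : ι ⊕ κ) :
    ⟪diagNoise ρ k, diagNoise ρ l⟫ = if k = l then crossSum ρ k else 0 := by
  by_cases h : k = l
  · subst h
    simp [diagNoise, Real.sq_sqrt (crossSum_nonneg ρ k)]
  · simp [diagNoise, EuclideanSpace.inner_single_left, h]

theorem inner_crossNoise (ρ : ι → κ → ℝ) (k l : ι ⊕ κ) :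
    ⟪crossNoise ρ k, crossNoise ρ l⟫ = (if k = l then crossSum ρ k else 0) +
      Sum.elim (fun i => Sum.elim (fun _ => 0) (fun j => ρ i j))
        (fun j => Sum.elim (fun i => ρ i j) (fun _ => 0)) k l := by
  have hs : ∀ x : ℝ, √|x| * √|x| = |x| := fun x => Real.mul_self_sqrt (abs_nonneg x)
  have hss : ∀ x : ℝ, (SignType.sign x : ℝ) * |x| = x := sign_mul_abs
  have hsq : ∀ x : ℝ, (SignType.sign x : ℝ) * (SignType.sign x : ℝ) * |x| = |x| := fun x => by
    rw [mul_assoc, hss, sign_mul_self]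
  rcases k with i | j <;> rcases l with i' | j'
  · simp only [crossNoise, crossSum, Sum.elim_inl, PiLp.inner_apply, Fintype.sum_prod_type]
    by_cases h : i = i'
    · subst h
      simp [Finset.sum_ite_irrel, Real.sq_sqrt]
    · simp [h, Finset.sum_ite_irrel]
  · simp only [crossNoise, Sum.elim_inl, Sum.elim_inr, PiLp.inner_apply, Fintype.sum_prod_type]
    simp [mul_assoc, hs, hss]
  · simp only [crossNoise, Sum.elim_inl, Sum.elim_inr, PiLp.inner_apply, Fintype.sum_prod_type]
    simp [mul_left_comm (√_), hs, hss]
  · simp only [crossNoise, crossSum, Sum.elim_inr, PiLp.inner_apply, Fintype.sum_prod_type]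
    by_cases h : j = j'
    · subst h
      simp [pow_two]
      exact Finset.sum_congr rfl fun x _ => by rw [mul_mul_mul_comm, hs, hsq]
    · simp [h]

/-- Adding `diagNoise` to the coupled family and `crossNoise` to the decoupled family produces equal
Gram matrices, hence equal expectations. Each noise vector has squared norm at most `η`, so each of
the two replacements costs `2 * c + η / c ^ 2` per functional. -/
theorem abs_integral_bits_mul_sub_le {u : ι → E} {v : κ → E} {A : ι → Set ℝ} {B : κ → Set ℝ}
    (hA : ∀ i, IsThreshold (A i) (u i)) (hB : ∀ j, IsThreshold (B j) (v j))
    {f : (ι → Bool) → ℝ} {g : (κ → Bool) → ℝ} (hf : ∀ b, f b ∈ Set.Icc (0 : ℝ) 1)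
    (hg : ∀ b, g b ∈ Set.Icc (0 : ℝ) 1) {c η : ℝ} (hc : 0 < c)
    (hη : ∑ i, ∑ j, |⟪u i, v j⟫| ≤ η) :
    |(∫ x, f (bits A fun i => ⟪u i, x⟫) * g (bits B fun j => ⟪v j, x⟫) ∂stdGaussian E) -
        (∫ x, f (bits A fun i => ⟪u i, x⟫) ∂stdGaussian E) *
          ∫ x, g (bits B fun j => ⟪v j, x⟫) ∂stdGaussian E| ≤
      2 * ((Fintype.card ι + Fintype.card κ : ℝ) * (2 * c + η / c ^ 2)) := by
  classical
  set ρ : ι → κ → ℝ := fun i j => ⟪u i, v j⟫ with hρ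
  let C : ι ⊕ κ → Set ℝ := Sum.elim A B
  let w : ι ⊕ κ → E := Sum.elim u v
  let F : (ι ⊕ κ → Bool) → ℝ := fun b => f (b ∘ Sum.inl) * g (b ∘ Sum.inr)
  have hF : ∀ b, F b ∈ Set.Icc (0 : ℝ) 1 := fun b =>
    ⟨mul_nonneg (hf _).1 (hg _).1, mul_le_one₀ (hf _).2 (hg _).1 (hg _).2⟩
  have hC : ∀ k, IsThreshold (C k) (w k) := by
    rintro (i | j)
    exacts [hA i, hB j]
  have hCm : ∀ k, MeasurableSet (C k) := fun k => (hC k).measurableSet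
  let w1 : ι ⊕ κ → WithLp 2 (E × EuclideanSpace ℝ (ι ⊕ κ)) := fun k => WithLp.toLp 2 (w k, 0)
  let w1' : ι ⊕ κ → WithLp 2 (E × EuclideanSpace ℝ (ι ⊕ κ)) :=
    fun k => WithLp.toLp 2 (w k, diagNoise ρ k)
  let z : ι ⊕ κ → WithLp 2 (E × E) :=
    Sum.elim (fun i => WithLp.toLp 2 (u i, 0)) (fun j => WithLp.toLp 2 (0, v j))
  -- In `z` the two families live in orthogonal copies of `E`, so under `w2` the expectation of the
  -- product factors.
  let w2 : ι ⊕ κ → WithLp 2 (WithLp 2 (E × E) × EuclideanSpace ℝ (ι × κ)) :=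
    fun k => WithLp.toLp 2 (z k, 0)
  let w2' : ι ⊕ κ → WithLp 2 (WithLp 2 (E × E) × EuclideanSpace ℝ (ι × κ)) :=
    fun k => WithLp.toLp 2 (z k, crossNoise ρ k)
  have hFm : Measurable fun y : ι ⊕ κ → ℝ => F (bits C y) :=
    (measurable_of_finite F).comp (measurable_bits hCm)
  have hfm : Measurable fun y : ι → ℝ => f (bits A y) :=
    (measurable_of_finite f).comp (measurable_bits fun i => (hA i).measurableSet)
  have hgm : Measurable fun y : κ → ℝ => g (bits B y) :=
    (measurable_of_finite g).comp (measurable_bits fun i => (hB i).measurableSet)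
  have e0 : (∫ x, f (bits A fun i => ⟪u i, x⟫) * g (bits B fun j => ⟪v j, x⟫) ∂stdGaussian E) =
      ∫ x, F (bits C fun k => ⟪w1 k, x⟫) ∂stdGaussian _ := by
    rw [← integral_inner_stdGaussian_congr (u := w) (v := w1) (by simp [w1]) hFm]
    rfl
  have e1 : (∫ x, F (bits C fun k => ⟪w1' k, x⟫) ∂stdGaussian _) =
      ∫ x, F (bits C fun k => ⟪w2' k, x⟫) ∂stdGaussian _ := by
    refine integral_inner_stdGaussian_congr (fun k l => ?_) hFm
    simp only [w1', w2', WithLp.prod_inner_apply, inner_diagNoise, inner_crossNoise]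
    rcases k with i | j <;> rcases l with i' | j' <;>
      simp [w, z, hρ, real_inner_comm]
  have e2 : (∫ x, F (bits C fun k => ⟪w2 k, x⟫) ∂stdGaussian _) =
      (∫ x, f (bits A fun i => ⟪u i, x⟫) ∂stdGaussian E) *
          ∫ x, g (bits B fun j => ⟪v j, x⟫) ∂stdGaussian E := by
    rw [integral_inner_stdGaussian_congr (u := u) (v := fun i => w2 (Sum.inl i))
      (by simp [w2, z]) hfm,
      integral_inner_stdGaussian_congr (u := v) (v := fun i => w2 (Sum.inr i))
      (by simp [w2, z]) hgm,
      ← integral_mul_stdGaussian_of_orthogonal (by simp [w2, z]) hfm hgm]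
    rfl
  have hη0 : 0 ≤ η := le_trans (Finset.sum_nonneg fun _ _ => Finset.sum_nonneg
    fun _ _ => abs_nonneg _) hη
  have hcard : ∀ s : ι ⊕ κ → ℝ, (∀ k, s k ≤ 2 * c + η / c ^ 2) →
      ∑ k, s k ≤ (Fintype.card ι + Fintype.card κ : ℝ) * (2 * c + η / c ^ 2) := fun s hs => by
    calc ∑ k, s k ≤ ∑ _k : ι ⊕ κ, (2 * c + η / c ^ 2) := Finset.sum_le_sum fun k _ => hs k
      _ = _ := by
        rw [Finset.sum_const, Finset.card_univ, Fintype.card_sum, nsmul_eq_mul, Nat.cast_add]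
  have b1 : |(∫ x, F (bits C fun k => ⟪w1 k, x⟫) ∂stdGaussian _) -
      ∫ x, F (bits C fun k => ⟪w1' k, x⟫) ∂stdGaussian _| ≤
      (Fintype.card ι + Fintype.card κ : ℝ) * (2 * c + η / c ^ 2) := by
    refine (abs_integral_bits_sub_le hCm hCm hF).trans (hcard _ fun k => ?_)
    have ht : IsThreshold (C k) (w1 k) := by
      rcases hC k with h | h | ⟨t, h, hn⟩
      · exact Or.inl h
      · exact Or.inr (Or.inl h)
      · refine Or.inr (Or.inr ⟨t, h, ?_⟩)
        simpa [w1, WithLp.prod_norm_eq_of_L2] using hn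
    refine (ht.measureReal_disagree_le (w1' k) hc).trans ?_
    gcongr
    have : w1' k - w1 k = WithLp.toLp 2 (0, diagNoise ρ k) := by
      simp [w1, w1', ← WithLp.toLp_sub]
    rw [this, ← real_inner_self_eq_norm_sq]
    simp only [WithLp.prod_inner_apply, inner_diagNoise]
    simpa using (crossSum_le ρ k).trans hη
  have b2 : |(∫ x, F (bits C fun k => ⟪w2 k, x⟫) ∂stdGaussian _) -
      ∫ x, F (bits C fun k => ⟪w2' k, x⟫) ∂stdGaussian _| ≤
      (Fintype.card ι + Fintype.card κ : ℝ) * (2 * c + η / c ^ 2) := by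
    refine (abs_integral_bits_sub_le hCm hCm hF).trans (hcard _ fun k => ?_)
    have ht : IsThreshold (C k) (w2 k) := by
      rcases hC k with h | h | ⟨t, h, hn⟩
      · exact Or.inl h
      · exact Or.inr (Or.inl h)
      · refine Or.inr (Or.inr ⟨t, h, ?_⟩)
        rcases k with i | j <;> simpa [w2, z, w, WithLp.prod_norm_eq_of_L2] using hn
    refine (ht.measureReal_disagree_le (w2' k) hc).trans ?_
    gcongr
    have : w2' k - w2 k = WithLp.toLp 2 (0, crossNoise ρ k) := by
      simp [w2, w2', ← WithLp.toLp_sub]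
    rw [this, ← real_inner_self_eq_norm_sq]
    simp only [WithLp.prod_inner_apply, inner_crossNoise]
    rcases k with i | j
    · simpa using (crossSum_le ρ (Sum.inl i)).trans hη
    · simpa using (crossSum_le ρ (Sum.inr j)).trans hη
  rw [e0, ← e2]
  rw [e1] at b1
  rw [abs_le] at b1 b2 ⊢
  constructor <;> linarith [b1.1, b1.2, b2.1, b2.2]

end Decoupling

/-! ### Lower bounds for the symmetric difference of half-spaces -/

section Separation

open scoped symmDiff

variable {E : Type*} [NormedAddCommGroup E] [InnerProductSpace ℝ E] [FiniteDimensional ℝ E]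
  [MeasurableSpace E] [BorelSpace E]

/-- The half-space `⟪u, x⟫ ≤ t`. -/
def halfSpace (u : E) (t : ℝ) : Set E := {x | ⟪u, x⟫ ≤ t}

theorem measurableSet_halfSpace (u : E) (t : ℝ) : MeasurableSet (halfSpace u t) :=
  (show Measurable fun x : E => ⟪u, x⟫ by fun_prop) measurableSet_Iic

theorem measureReal_halfSpace {u : E} (hu : ‖u‖ = 1) (t : ℝ) :
    (stdGaussian E).real (halfSpace u t) = (gaussianReal 0 1).real (Set.Iic t) :=
  measureReal_inner_mem_of_norm_eq_one hu measurableSet_Iic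

theorem abs_measureReal_sub_le_measureReal_symmDiff {α : Type*} [MeasurableSpace α]
    (μ : Measure α) [IsFiniteMeasure μ] (s t : Set α) :
    |μ.real s - μ.real t| ≤ μ.real (s ∆ t) := by
  have h1 : μ.real s ≤ μ.real t + μ.real (s ∆ t) :=
    (measureReal_mono fun x hx => by
      by_cases h : x ∈ t
      · exact Or.inl h
      · exact Or.inr (Or.inl ⟨hx, h⟩)).trans (measureReal_union_le _ _)
  have h2 : μ.real t ≤ μ.real s + μ.real (s ∆ t) :=
    (measureReal_mono fun x hx => by
      by_cases h : x ∈ s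
      · exact Or.inl h
      · exact Or.inr (Or.inr ⟨hx, h⟩)).trans (measureReal_union_le _ _)
  rw [abs_le]
  constructor <;> linarith

/-- Half of the mass of an event depending on `⟪u, x⟫` lies on one side of an orthogonal
hyperplane. -/
theorem measureReal_le_two_mul_inter_halfSpace {u z : E} (h : ⟪u, z⟫ = 0) {s : Set ℝ}
    (hs : MeasurableSet s) :
    (stdGaussian E).real {x | ⟪u, x⟫ ∈ s} ≤
      2 * (stdGaussian E).real {x | ⟪u, x⟫ ∈ s ∧ ⟪z, x⟫ ≤ 0} := by
  have hm : MeasurableSet {y : Fin 2 → ℝ | y 0 ∈ s ∧ y 1 ≤ 0} :=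
    ((measurable_pi_apply 0) hs).inter ((measurable_pi_apply 1) measurableSet_Iic)
  have hg : ∀ i j : Fin 2, ⟪![u, z] i, ![u, z] j⟫ = ⟪![u, -z] i, ![u, -z] j⟫ := by
    have h' : ⟪z, u⟫ = 0 := by rw [real_inner_comm]; exact h
    intro i j
    fin_cases i <;> fin_cases j <;> simp [h, h']
  have e := measureReal_inner_stdGaussian_congr hg hm
  simp only [Set.mem_ofPred_eq, Matrix.cons_val_zero, Matrix.cons_val_one, inner_neg_left] at e
  have hsub : {x : E | ⟪u, x⟫ ∈ s} ⊆ {x | ⟪u, x⟫ ∈ s ∧ ⟪z, x⟫ ≤ 0} ∪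
      {x | ⟪u, x⟫ ∈ s ∧ -⟪z, x⟫ ≤ 0} := by
    intro x hx
    rcases le_total ⟪z, x⟫ 0 with h | h
    · exact Or.inl ⟨hx, h⟩
    · exact Or.inr ⟨hx, by linarith⟩
  have := (measureReal_mono (μ := stdGaussian E) hsub).trans (measureReal_union_le _ _)
  rw [← e] at this
  linarith

/-- Split `v = z + ⟪u, v⟫ • u` with `z` orthogonal to `u`. For `t ≥ 0`, wherever `⟪u, x⟫ > t` and
`⟪z, x⟫ ≤ 0`, the obtuse angle forces `⟪v, x⟫ ≤ 0 ≤ t`; by reflection this is at least half of the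
tail. The case `t < 0` is symmetric. -/
theorem min_le_measureReal_halfSpace_diff {u v : E} (hu : ‖u‖ = 1) (huv : ⟪u, v⟫ ≤ 0) (t : ℝ) :
    (0 ≤ t → 1 - (gaussianReal 0 1).real (Set.Iic t) ≤
      2 * (stdGaussian E).real (halfSpace v t \ halfSpace u t)) ∧
    (t < 0 → (gaussianReal 0 1).real (Set.Iic t) ≤
      2 * (stdGaussian E).real (halfSpace u t \ halfSpace v t)) := by
  set z := v - ⟪u, v⟫ • u with hz
  have huz : ⟪u, z⟫ = 0 := by
    rw [hz, inner_sub_right, inner_smul_right, real_inner_self_eq_norm_sq, hu]; ring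
  have hzx : ∀ x, ⟪v, x⟫ = ⟪z, x⟫ + ⟪u, v⟫ * ⟪u, x⟫ := fun x => by
    rw [hz, inner_sub_left, real_inner_smul_left]; ring
  constructor
  · intro ht
    have h1 : 1 - (gaussianReal 0 1).real (Set.Iic t) = (gaussianReal 0 1).real (Set.Ioi t) := by
      rw [← probReal_compl_eq_one_sub measurableSet_Iic, Set.compl_Iic]
    rw [h1, ← measureReal_inner_mem_of_norm_eq_one hu measurableSet_Ioi]
    refine (measureReal_le_two_mul_inter_halfSpace huz measurableSet_Ioi).trans ?_
    refine mul_le_mul_of_nonneg_left (measureReal_mono ?_) zero_le_two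
    rintro x ⟨hx1, hx2⟩
    simp only [Set.mem_Ioi] at hx1
    simp only [halfSpace, Set.mem_sdiff, Set.mem_ofPred_eq, not_le]
    refine ⟨?_, hx1⟩
    rw [hzx]
    nlinarith [mul_nonneg (neg_nonneg.2 huv) (ht.trans hx1.le)]
  · intro ht
    rw [← measureReal_inner_mem_of_norm_eq_one hu measurableSet_Iic]
    have huz' : ⟪u, -z⟫ = 0 := by rw [inner_neg_right, huz, neg_zero]
    refine (measureReal_le_two_mul_inter_halfSpace huz' measurableSet_Iic).trans ?_
    refine mul_le_mul_of_nonneg_left (measureReal_mono ?_) zero_le_two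
    rintro x ⟨hx1, hx2⟩
    simp only [Set.mem_Iic] at hx1
    simp only [halfSpace, Set.mem_sdiff, Set.mem_ofPred_eq, not_le]
    refine ⟨hx1, ?_⟩
    rw [hzx]
    rw [inner_neg_left] at hx2
    nlinarith [mul_nonneg (neg_nonneg.2 huv) (neg_nonneg.2 (hx1.trans ht.le))]

theorem min_le_measureReal_symmDiff {u v : E} (hu : ‖u‖ = 1) (hv : ‖v‖ = 1) (huv : ⟪u, v⟫ ≤ 0)
    (t : ℝ) :
    min ((gaussianReal 0 1).real (Set.Iic t)) (1 - (gaussianReal 0 1).real (Set.Iic t)) ≤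
      (stdGaussian E).real (halfSpace u t ∆ halfSpace v t) := by
  have hvu : ⟪v, u⟫ ≤ 0 := by rwa [real_inner_comm]
  rw [measureReal_symmDiff_eq (measurableSet_halfSpace u t)
    (measurableSet_halfSpace v t)]
  obtain ⟨a1, a2⟩ := min_le_measureReal_halfSpace_diff hu huv t
  obtain ⟨b1, b2⟩ := min_le_measureReal_halfSpace_diff hv hvu t
  rcases le_or_gt 0 t with ht | ht
  · refine (min_le_right _ _).trans ?_
    linarith [a1 ht, b1 ht]
  · refine (min_le_left _ _).trans ?_
    linarith [a2 ht, b2 ht]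

/-- Two half-spaces with the same threshold and correlation `ρ` differ on a set of measure at least
proportional to `1 - ρ`. The proof doubles the angle between the normals until it is obtuse. -/
theorem mul_min_le_measureReal_symmDiff_same {u v : E} (hu : ‖u‖ = 1) (hv : ‖v‖ = 1) (t : ℝ) :
    (1 - ⟪u, v⟫) / 2 *
      min ((gaussianReal 0 1).real (Set.Iic t)) (1 - (gaussianReal 0 1).real (Set.Iic t)) ≤
      (stdGaussian E).real (halfSpace u t ∆ halfSpace v t) := by
  set m := min ((gaussianReal 0 1).real (Set.Iic t)) (1 - (gaussianReal 0 1).real (Set.Iic t))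
    with hm
  have hm0 : 0 ≤ m := le_min measureReal_nonneg (sub_nonneg.2 measureReal_le_one)
  have base : ∀ {u v : E}, ‖u‖ = 1 → ‖v‖ = 1 → ⟪u, v⟫ ≤ 0 → (1 - ⟪u, v⟫) / 2 * m ≤
      (stdGaussian E).real (halfSpace u t ∆ halfSpace v t) := by
    intro u v hu hv huv
    refine le_trans ?_ (min_le_measureReal_symmDiff hu hv huv t)
    have : -1 ≤ ⟪u, v⟫ := by
      have := abs_real_inner_le_norm u v
      rw [hu, hv, abs_le] at this
      linarith [this.1]
    nlinarith
  -- Here `k` bounds the number of doublings: for `ρ > 0` a doubling replaces `1 - ρ` by `2 * (1 -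
  -- ρ) * (1 + ρ)`, at least twice as much, and `k = 0` means `ρ ≤ 0`.
  have key : ∀ k : ℕ, ∀ u v : E, ‖u‖ = 1 → ‖v‖ = 1 → 1 ≤ 2 ^ k * (1 - ⟪u, v⟫) →
      (1 - ⟪u, v⟫) / 2 * m ≤ (stdGaussian E).real (halfSpace u t ∆ halfSpace v t) := by
    intro k
    induction k with
    | zero =>
      intro u v hu hv h
      exact base hu hv (by linarith [h])
    | succ k ih =>
      intro u v hu hv h
      rcases le_or_gt ⟪u, v⟫ 0 with h0 | h0
      · exact base hu hv h0
      set ρ := ⟪u, v⟫ with hρ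
      have hρ1 : ρ ≤ 1 := by
        have := real_inner_le_norm u v
        rwa [hu, hv, one_mul] at this
      have huu : ⟪u, u⟫ = 1 := by rw [real_inner_self_eq_norm_sq, hu]; norm_num
      have hvv : ⟪v, v⟫ = 1 := by rw [real_inner_self_eq_norm_sq, hv]; norm_num
      have hvu : ⟪v, u⟫ = ρ := by rw [real_inner_comm]
      -- The reflection of `u` in the line of `v`. The pair `(v, w)` has the Gram matrix of `(u,
      -- v)`, so the triangle inequality bounds the difference for `(u, w)` by twice that for `(u,
      -- v)`.
      set w := (2 * ρ) • v - u with hw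
      have hvw : ⟪v, w⟫ = ρ := by
        rw [hw, inner_sub_right, inner_smul_right, hvv, hvu]; ring
      have huw : ⟪u, w⟫ = 2 * ρ ^ 2 - 1 := by
        rw [hw, inner_sub_right, inner_smul_right, ← hρ, huu]; ring
      have hww : ⟪w, w⟫ = 1 := by
        rw [hw, inner_sub_left, inner_smul_left, ← hw, hvw, huw]; simp; ring
      have hwn : ‖w‖ = 1 := by
        rw [real_inner_self_eq_norm_sq] at hww
        nlinarith [norm_nonneg w]
      have hwv : ⟪w, v⟫ = ρ := by rw [real_inner_comm, hvw]
      have hms : MeasurableSet {y : Fin 2 → ℝ | ¬(y 0 ≤ t ↔ y 1 ≤ t)} :=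
        MeasurableSet.compl (MeasurableSet.iff ((measurable_pi_apply 0) measurableSet_Iic)
          ((measurable_pi_apply 1) measurableSet_Iic))
      have hg : ∀ i j : Fin 2, ⟪![u, v] i, ![u, v] j⟫ = ⟪![v, w] i, ![v, w] j⟫ := by
        intro i j
        fin_cases i <;> fin_cases j <;> simp [hu, hv, hwn, hvu, hvw, hwv, ← hρ]
      have e := measureReal_inner_stdGaussian_congr hg hms
      have hset : ∀ a b : E, {x : E | (fun i => ⟪![a, b] i, x⟫) ∈
          {y : Fin 2 → ℝ | ¬(y 0 ≤ t ↔ y 1 ≤ t)}} = halfSpace a t ∆ halfSpace b t := by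
        intro a b
        ext x
        simp only [Set.mem_ofPred_eq, Matrix.cons_val_zero, Matrix.cons_val_one, halfSpace,
          Set.mem_symmDiff]
        tauto
      rw [hset, hset] at e
      have htri := measureReal_symmDiff_le (μ := stdGaussian E) (s := halfSpace u t)
        (t := halfSpace v t) (halfSpace w t)
      have hpow : (0 : ℝ) < 2 ^ k := by positivity
      have hih := ih u w hu hwn (by
        rw [huw]
        rw [pow_succ] at h
        nlinarith [mul_nonneg hpow.le (mul_nonneg h0.le (sub_nonneg.2 hρ1))])
      rw [huw] at hih
      have : (1 - ρ) * m ≤ (1 - (2 * ρ ^ 2 - 1)) / 2 * m := by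
        apply mul_le_mul_of_nonneg_right _ hm0
        nlinarith
      linarith
  have hρ1 : ⟪u, v⟫ ≤ 1 := by
    have := real_inner_le_norm u v
    rwa [hu, hv, one_mul] at this
  rcases hρ1.lt_or_eq with h | h
  · obtain ⟨k, hk⟩ := pow_unbounded_of_one_lt (1 / (1 - ⟪u, v⟫)) one_lt_two
    refine key k u v hu hv ?_
    rw [div_lt_iff₀ (by linarith)] at hk
    exact hk.le
  · rw [h]; simp

/-- Changing the threshold of `v` from `t` to `s` moves mass equal to the difference of the measures
of the original two half-spaces, which their symmetric difference already dominates. Hence the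
factor `2`. -/
theorem mul_min_le_measureReal_symmDiff {u v : E} (hu : ‖u‖ = 1) (hv : ‖v‖ = 1) (s t : ℝ) :
    (1 - ⟪u, v⟫) / 2 *
      min ((gaussianReal 0 1).real (Set.Iic s)) (1 - (gaussianReal 0 1).real (Set.Iic s)) ≤
      2 * (stdGaussian E).real (halfSpace u s ∆ halfSpace v t) := by
  have h1 := mul_min_le_measureReal_symmDiff_same hu hv s
  have h2 := measureReal_symmDiff_le (μ := stdGaussian E) (s := halfSpace u s)
    (t := halfSpace v t) (halfSpace v s)
  have h3 : (stdGaussian E).real (halfSpace v t ∆ halfSpace v s) =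
      |(stdGaussian E).real (halfSpace v t) - (stdGaussian E).real (halfSpace v s)| := by
    rw [measureReal_symmDiff_eq (measurableSet_halfSpace v t)
      (measurableSet_halfSpace v s)]
    rcases le_total s t with h | h
    · have hsub : halfSpace v s ⊆ halfSpace v t := fun x (hx : _ ≤ s) => hx.trans h
      rw [measureReal_sdiff hsub (measurableSet_halfSpace v s), Set.sdiff_eq_empty.2 hsub,
        abs_of_nonneg (sub_nonneg.2 (measureReal_mono hsub))]
      simp
    · have hsub : halfSpace v t ⊆ halfSpace v s := fun x (hx : _ ≤ t) => hx.trans h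
      rw [measureReal_sdiff hsub (measurableSet_halfSpace v t), Set.sdiff_eq_empty.2 hsub,
        abs_of_nonpos (sub_nonpos.2 (measureReal_mono hsub))]
      simp
  have h4 := abs_measureReal_sub_le_measureReal_symmDiff (stdGaussian E) (halfSpace u s)
    (halfSpace v t)
  rw [measureReal_halfSpace hu, measureReal_halfSpace hv] at h4
  rw [measureReal_halfSpace hv, measureReal_halfSpace hv, abs_sub_comm] at h3
  linarith

end Separation

/-! ### The Gaussian quantile and its acceptance sets -/

section Quantile

/-- The set of reals at most `gaussianQuantile p`. -/
def quantileSet (p : ℝ) : Set ℝ := {x | (x : EReal) ≤ gaussianQuantile p}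

theorem cdf_gaussianReal_sub {a b : ℝ} (hab : a ≤ b) :
    cdf (gaussianReal 0 1) b - cdf (gaussianReal 0 1) a =
      (gaussianReal 0 1).real (Set.Ioc a b) := by
  rw [cdf_eq_real, cdf_eq_real, ← Set.Iic_sdiff_Iic,
    measureReal_sdiff (Set.Iic_subset_Iic.2 hab) measurableSet_Iic]

theorem strictMono_cdf_gaussianReal : StrictMono (cdf (gaussianReal 0 1)) := by
  intro a b hab
  rw [← sub_pos, cdf_gaussianReal_sub hab.le, measureReal_def]
  refine ENNReal.toReal_pos (fun h => ?_) (measure_ne_top _ _)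
  have := gaussianReal_absolutelyContinuous' 0 one_ne_zero h
  rw [Real.volume_Ioc, ENNReal.ofReal_eq_zero] at this
  linarith

theorem continuous_cdf_gaussianReal : Continuous (cdf (gaussianReal 0 1)) := by
  have key : ∀ a b, a ≤ b → cdf (gaussianReal 0 1) b - cdf (gaussianReal 0 1) a ≤ b - a :=
    fun a b hab => by
      rw [cdf_gaussianReal_sub hab]
      exact (measureReal_mono Set.Ioc_subset_Icc_self).trans (gaussianReal_real_Icc_le a b hab)
  refine (LipschitzWith.of_le_add fun a b => ?_).continuous
  rcases le_total a b with h | h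
  · exact (monotone_cdf _ h).trans (le_add_of_nonneg_right dist_nonneg)
  · rw [Real.dist_eq, abs_of_nonneg (sub_nonneg.2 h)]
    linarith [key b a h]

/-- The supremum over the empty set is `⊥`, below every real number, so bias `-1` always rounds to
`false`. -/
theorem quantileSet_zero : quantileSet 0 = ∅ := by
  have h : ∀ x, ¬ cdf (gaussianReal 0 1) x ≤ 0 := fun x hx =>
    absurd (strictMono_cdf_gaussianReal (sub_one_lt x))
      (not_lt.2 (hx.trans (cdf_nonneg _ _)))
  ext x
  simp [quantileSet, gaussianQuantile, h]

theorem quantileSet_one : quantileSet 1 = Set.univ := by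
  ext x
  simp only [quantileSet, Set.mem_ofPred_eq, Set.mem_univ, iff_true]
  exact le_iSup₂_of_le x (cdf_le_one _ x) le_rfl

theorem quantileSet_eq_Iic {p : ℝ} (h0 : 0 < p) (h1 : p < 1) :
    ∃ t, quantileSet p = Set.Iic t ∧ (gaussianReal 0 1).real (Set.Iic t) = p := by
  obtain ⟨t, ht⟩ : p ∈ Set.range (cdf (gaussianReal 0 1)) := by
    refine mem_range_of_exists_le_of_exists_ge continuous_cdf_gaussianReal ?_ ?_
    · obtain ⟨x, hx⟩ := ((tendsto_cdf_atBot (gaussianReal 0 1)).eventually_lt_const h0).exists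
      exact ⟨x, hx.le⟩
    · obtain ⟨x, hx⟩ := ((tendsto_cdf_atTop (gaussianReal 0 1)).eventually_const_lt h1).exists
      exact ⟨x, hx.le⟩
  refine ⟨t, ?_, by rw [← cdf_eq_real, ht]⟩
  have hq : gaussianQuantile p = t := by
    apply le_antisymm
    · refine iSup₂_le fun x hx => ?_
      rw [Set.mem_ofPred_eq, ← ht, strictMono_cdf_gaussianReal.le_iff_le] at hx
      exact_mod_cast hx
    · exact le_iSup₂_of_le (f := fun (x : ℝ) (_ : x ∈ {x : ℝ | cdf (gaussianReal 0 1) x ≤ p}) =>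
        (x : EReal)) t ht.le le_rfl
  ext x
  simp [quantileSet, hq]

end Quantile

/-! ### Estimates for the rounding function -/

section RoundingFunction

theorem fR_neg (x : ℝ) : fR (-x) = -fR x := by
  unfold fR; ring

theorem fR_one : fR 1 = 1 := by
  norm_num [fR]

theorem fR_sub_ge {x y : ℝ} (h : y ≤ x) : 0.79 * (x - y) ≤ fR x - fR y := by
  have h3 : y ^ 3 ≤ x ^ 3 := (Odd.strictMono_pow (by decide : Odd 3)).monotone h
  have h7 : y ^ 7 ≤ x ^ 7 := (Odd.strictMono_pow (by decide : Odd 7)).monotone h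
  unfold fR
  linarith

/-- Bernoulli's inequality gives the slope of `fR` at `1`, namely `0.79 + 0.21 + 0.98 = 1.98`. -/
theorem one_sub_fR_le {x : ℝ} (h0 : 0 ≤ x) (h1 : x ≤ 1) : 1 - fR x ≤ 2 * (1 - x) := by
  have b3 := one_add_mul_le_pow (a := x - 1) (by linarith) 3
  have b7 := one_add_mul_le_pow (a := x - 1) (by linarith) 7
  norm_num at b3 b7
  unfold fR
  linarith

/-- The probability that the rounded value is `1`. -/
def roundProb (μ : ℝ) : ℝ := fR μ / 2 + 1 / 2

theorem roundProb_neg (μ : ℝ) : roundProb (-μ) = 1 - roundProb μ := by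
  unfold roundProb; rw [fR_neg]; ring

theorem roundProb_one : roundProb 1 = 1 := by
  norm_num [roundProb, fR_one]

theorem roundProb_neg_one : roundProb (-1) = 0 := by
  rw [roundProb_neg, roundProb_one, sub_self]

theorem roundProb_mem_Ioo {μ : ℝ} (h1 : -1 < μ) (h2 : μ < 1) :
    0 < roundProb μ ∧ roundProb μ < 1 := by
  have a := fR_sub_ge h1.le
  have b := fR_sub_ge h2.le
  rw [fR_neg, fR_one] at a
  rw [fR_one] at b
  unfold roundProb
  constructor <;> linarith

theorem abs_sub_le_abs_roundProb_sub (μ ν : ℝ) :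
    0.395 * |μ - ν| ≤ |roundProb μ - roundProb ν| := by
  unfold roundProb
  rcases le_total ν μ with h | h
  · have := fR_sub_ge h
    rw [abs_of_nonneg (sub_nonneg.2 h)]
    refine le_trans ?_ (le_abs_self _)
    linarith
  · have := fR_sub_ge h
    rw [abs_of_nonpos (sub_nonpos.2 h)]
    refine le_trans ?_ (neg_le_abs _)
    linarith

theorem mul_le_min_roundProb {μ : ℝ} (h1 : -1 ≤ μ) (h2 : μ ≤ 1) :
    0.19 * (1 - μ ^ 2) ≤ min (roundProb μ) (1 - roundProb μ) := by
  have a := fR_sub_ge h1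
  have b := fR_sub_ge h2
  rw [fR_neg, fR_one] at a
  rw [fR_one] at b
  unfold roundProb
  refine le_min ?_ ?_ <;> nlinarith

theorem min_roundProb_le {μ : ℝ} (h1 : -1 ≤ μ) (h2 : μ ≤ 1) :
    min (roundProb μ) (1 - roundProb μ) ≤ 1 - μ ^ 2 := by
  rcases le_total 0 μ with h | h
  · have := one_sub_fR_le h h2
    refine (min_le_right _ _).trans ?_
    unfold roundProb
    nlinarith
  · have := one_sub_fR_le (neg_nonneg.2 h) (by linarith)
    rw [fR_neg] at this
    refine (min_le_left _ _).trans ?_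
    unfold roundProb
    nlinarith

end RoundingFunction

/-! ### Mutual information and covariance -/

section Information

/-- A pointwise Pinsker inequality through the Hellinger distance: `log y ≤ y - 1` at `y = √q / √p`
gives `p * log (p / q) ≥ (p - q) + (√p - √q) ^ 2`, and `√p + √q ≤ 2`. -/
theorem sq_div_four_add_sub_le_mul_log {p q : ℝ} (hp0 : 0 ≤ p) (hq0 : 0 ≤ q) (hp1 : p ≤ 1)
    (hq1 : q ≤ 1) (h : q = 0 → p = 0) :
    (p - q) ^ 2 / 4 + (p - q) ≤ p * Real.log (p / q) := by
  rcases hp0.eq_or_lt with rfl | hp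
  · simp; nlinarith
  have hq : 0 < q := hq0.lt_of_ne fun h' => hp.ne' (h h'.symm)
  obtain ⟨a, ha, rfl⟩ : ∃ a : ℝ, 0 < a ∧ p = a ^ 2 :=
    ⟨√p, Real.sqrt_pos.2 hp, (Real.sq_sqrt hp0).symm⟩
  obtain ⟨b, hb, rfl⟩ : ∃ b : ℝ, 0 < b ∧ q = b ^ 2 :=
    ⟨√q, Real.sqrt_pos.2 hq, (Real.sq_sqrt hq0).symm⟩
  have ha1 : a ≤ 1 := by nlinarith
  have hb1 : b ≤ 1 := by nlinarith
  have hlog : Real.log (a ^ 2 / b ^ 2) = -(2 * Real.log (b / a)) := by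
    rw [Real.log_div (by positivity) (by positivity), Real.log_div hb.ne' ha.ne', Real.log_pow,
      Real.log_pow]
    push_cast; ring
  have h1 : Real.log (b / a) ≤ b / a - 1 := Real.log_le_sub_one_of_pos (by positivity)
  have h2 : a ^ 2 * (b / a - 1) = a * b - a ^ 2 := by field_simp
  have h3 : a ^ 2 * Real.log (b / a) ≤ a * b - a ^ 2 := by
    rw [← h2]; exact mul_le_mul_of_nonneg_left h1 (by positivity)
  rw [hlog]
  have h4 : (a - b) ^ 2 * (a + b) ^ 2 ≤ (a - b) ^ 2 * 4 :=
    mul_le_mul_of_nonneg_left (by nlinarith) (sq_nonneg _)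
  nlinarith

/-- Mutual information controls the square of the covariance. -/
theorem sq_le_mutualInfo {P : Bool → Bool → ℝ} (h0 : ∀ a b, 0 ≤ P a b)
    (h1 : ∑ a, ∑ b, P a b = 1) :
    (P true true - (∑ b, P true b) * ∑ a, P a true) ^ 2 ≤ mutualInfo P := by
  have hterm : ∀ a b, (P a b - (∑ b', P a b') * ∑ a', P a' b) ^ 2 / 4 +
      (P a b - (∑ b', P a b') * ∑ a', P a' b) ≤
      P a b * Real.log (P a b / ((∑ b', P a b') * ∑ a', P a' b)) := by
    intro a b
    have hr : ∀ a, 0 ≤ ∑ b', P a b' := fun a => Finset.sum_nonneg fun b' _ => h0 a b'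
    have hc : ∀ b, 0 ≤ ∑ a', P a' b := fun b => Finset.sum_nonneg fun a' _ => h0 a' b
    have hr1 : ∀ a, ∑ b', P a b' ≤ 1 := fun a => by
      rw [← h1]
      exact Finset.single_le_sum (f := fun a => ∑ b', P a b') (fun a _ => hr a)
        (Finset.mem_univ a)
    have hc1 : ∀ b, ∑ a', P a' b ≤ 1 := fun b => by
      rw [← h1, Finset.sum_comm]
      exact Finset.single_le_sum (f := fun b => ∑ a', P a' b) (fun b _ => hc b)
        (Finset.mem_univ b)
    have hPr : P a b ≤ ∑ b', P a b' :=
      Finset.single_le_sum (f := fun b' => P a b') (fun b' _ => h0 a b') (Finset.mem_univ b)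
    have hPc : P a b ≤ ∑ a', P a' b :=
      Finset.single_le_sum (f := fun a' => P a' b) (fun a' _ => h0 a' b) (Finset.mem_univ a)
    refine sq_div_four_add_sub_le_mul_log (h0 a b) (mul_nonneg (hr a) (hc b))
      (hPr.trans (hr1 a)) (mul_le_one₀ (hr1 a) (hc b) (hc1 b)) fun h => ?_
    rcases mul_eq_zero.1 h with h | h
    · exact le_antisymm (h ▸ hPr) (h0 a b)
    · exact le_antisymm (h ▸ hPc) (h0 a b)
  -- All four cells deviate from the product distribution by plus or minus the covariance. The
  -- linear terms cancel, and four quarters of its square remain.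
  have hsum : (P true true - (∑ b, P true b) * ∑ a, P a true) ^ 2 ≤
      ∑ a, ∑ b, P a b * Real.log (P a b / ((∑ b', P a b') * ∑ a', P a' b)) := by
    refine le_trans (le_of_eq ?_)
      (Finset.sum_le_sum fun a _ => Finset.sum_le_sum fun b _ => hterm a b)
    simp only [Fintype.sum_bool] at h1 ⊢
    have : P false false = 1 - P true true - P true false - P false true := by linarith
    rw [this]
    ring
  have hlog2 : 0 < Real.log 2 := Real.log_pos one_lt_two
  have hlog2' : Real.log 2 ≤ 1 := by linarith [Real.log_two_lt_d9]
  have hI : mutualInfo P * Real.log 2 =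
      ∑ a, ∑ b, P a b * Real.log (P a b / ((∑ b', P a b') * ∑ a', P a' b)) := by
    simp only [mutualInfo, Finset.sum_mul, Real.logb, mul_assoc, div_mul_cancel₀ _ hlog2.ne']
  rw [← hI] at hsum
  -- Nonnegativity is needed to pass from nats to bits, using `log 2 ≤ 1`.
  have hI0 : 0 ≤ mutualInfo P := by
    by_contra h
    rw [not_le] at h
    nlinarith [sq_nonneg (P true true - (∑ b, P true b) * ∑ a, P a true)]
  nlinarith

end Information

/-! ### First and second moments of a Lasserre solution -/

section Lasserre

variable {n d r k : ℕ} {ε : ℝ} {E : Fin k → Instance n} {c : Fin k → ℝ}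
  {S : Finset (Fin n)} {h : S → Bool} {L : Finset (Fin k)} {v : VectorFamily n d}

/-- The sign of a bit. -/
def bitSign (b : Bool) : ℝ := if b then 1 else -1

namespace IsLasserreSolution

theorem inner_empty_self (H : IsLasserreSolution r ε E c S h L v) : ⟪v.empty, v.empty⟫ = 1 := by
  rw [real_inner_self_eq_norm_sq, H.norm_empty]

theorem inner_single_empty (H : IsLasserreSolution r ε E c S h L v) (hr : 2 ≤ r) (i : Fin n)
    (b : Bool) : ⟪v.single i b, v.empty⟫ = ‖v.single i b‖ ^ 2 :=
  (H.norm_sq {i} (fun _ => b) (by simp; omega)).symm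

theorem inner_single_of_ne (H : IsLasserreSolution r ε E c S h L v) (hr : 2 ≤ r) (i : Fin n)
    {a b : Bool} (hab : a ≠ b) : ⟪v.single i a, v.single i b⟫ = 0 :=
  H.inconsistent {i} {i} (by simp; omega) _ _ ⟨i, by simp, by simp, hab⟩

theorem norm_sq_single_add (H : IsLasserreSolution r ε E c S h L v) (hr : 2 ≤ r) (i : Fin n) :
    ‖v.single i true‖ ^ 2 + ‖v.single i false‖ ^ 2 = 1 := by
  rw [← H.total_prob {i} (by simp; omega), ← Fintype.sum_bool (fun b => ‖v.single i b‖ ^ 2)]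
  refine Fintype.sum_equiv ⟨fun b _ => b, fun γ => γ ⟨i, by simp⟩, fun b => rfl, fun γ => ?_⟩
    _ _ fun b => rfl
  ext ⟨j, hj⟩
  obtain rfl := Finset.mem_singleton.1 hj
  rfl

theorem single_true_add_single_false (H : IsLasserreSolution r ε E c S h L v) (hr : 2 ≤ r)
    (i : Fin n) : v.single i true + v.single i false = v.empty := by
  rw [← sub_eq_zero, ← inner_self_eq_zero (𝕜 := ℝ)]
  have h1 := H.inner_single_empty hr i true
  have h2 := H.inner_single_empty hr i false
  have h3 := H.norm_sq_single_add hr i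
  have h4 := H.inner_single_of_ne hr i (a := true) (b := false) (by simp)
  have h5 := H.inner_single_of_ne hr i (a := false) (b := true) (by simp)
  have h1' : ⟪v.empty, v.single i true⟫ = ‖v.single i true‖ ^ 2 := by rw [real_inner_comm, h1]
  have h2' : ⟪v.empty, v.single i false⟫ = ‖v.single i false‖ ^ 2 := by rw [real_inner_comm, h2]
  simp only [inner_sub_left, inner_sub_right, inner_add_left, inner_add_right, h1, h2, h4, h5,
    h1', h2', H.inner_empty_self, real_inner_self_eq_norm_sq (v.single i _)]
  linarith

theorem single_eq (H : IsLasserreSolution r ε E c S h L v) (hr : 2 ≤ r) (i : Fin n) (b : Bool) :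
    v.single i b = (1 / 2 : ℝ) • (v.empty + bitSign b • v.vec i) := by
  rw [← H.single_true_add_single_false hr i, VectorFamily.vec]
  cases b
  · simp only [bitSign, Bool.false_eq_true, if_false]; module
  · simp only [bitSign, if_true]; module

theorem inner_empty_vec (H : IsLasserreSolution r ε E c S h L v) (hr : 2 ≤ r) (i : Fin n) :
    ⟪v.empty, v.vec i⟫ = v.bias i := by
  have h1 := H.inner_single_empty hr i true
  have h2 := H.inner_single_empty hr i false
  have h3 := H.norm_sq_single_add hr i
  have h4 : v.localProb {i} (fun _ => true) = ‖v.single i true‖ ^ 2 := rfl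
  rw [VectorFamily.vec, VectorFamily.bias, real_inner_comm, inner_sub_left, h1, h2, h4]
  linarith

theorem inner_vec_self (H : IsLasserreSolution r ε E c S h L v) (hr : 2 ≤ r) (i : Fin n) :
    ⟪v.vec i, v.vec i⟫ = 1 := by
  have h3 := H.norm_sq_single_add hr i
  have h4 := H.inner_single_of_ne hr i (a := true) (b := false) (by simp)
  have h5 := H.inner_single_of_ne hr i (a := false) (b := true) (by simp)
  simp only [VectorFamily.vec, inner_sub_left, inner_sub_right, h4, h5,
    real_inner_self_eq_norm_sq (v.single i _)]
  linarith

theorem norm_sq_pair (H : IsLasserreSolution r ε E c S h L v) (hr : 2 ≤ r) (i j : Fin n)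
    (γ : ({i, j} : Finset (Fin n)) → Bool) :
    ‖v {i, j} γ‖ ^ 2 =
      ⟪v.single i (γ ⟨i, by simp⟩), v.single j (γ ⟨j, by simp⟩)⟫ := by
  have hcard : (({i} : Finset (Fin n)) ∪ {j}).card ≤ r :=
    (Finset.card_union_le _ _).trans (by simpa using hr)
  refine (H.consistent {i} {j} hcard γ).symm.trans ?_
  congr 1
  · refine congrArg (v {i}) (funext fun x => ?_)
    obtain ⟨x, hx⟩ := x
    obtain rfl := Finset.mem_singleton.1 hx
    rfl
  · refine congrArg (v {j}) (funext fun x => ?_)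
    obtain ⟨x, hx⟩ := x
    obtain rfl := Finset.mem_singleton.1 hx
    rfl

theorem pairProb_eq_inner (H : IsLasserreSolution r ε E c S h L v) (hr : 2 ≤ r) (i j : Fin n)
    (a b : Bool) : v.pairProb i j a b = ⟪v.single i a, v.single j b⟫ := by
  unfold VectorFamily.pairProb
  by_cases hab : i = j ∧ a ≠ b
  · obtain ⟨rfl, hab⟩ := hab
    rw [H.inner_single_of_ne hr i hab]
    refine Finset.sum_eq_zero fun γ _ => if_neg ?_
    rintro ⟨h1, h2⟩
    exact hab (h1.symm.trans h2)
  · let γ₀ : ({i, j} : Finset (Fin n)) → Bool := fun x => if x.1 = i then a else b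
    have hi : γ₀ ⟨i, by simp⟩ = a := by simp [γ₀]
    have hj : γ₀ ⟨j, by simp⟩ = b := by
      by_cases hij : j = i
      · simp only [γ₀, hij, if_true]
        by_contra hne
        exact hab ⟨hij.symm, hne⟩
      · simp [γ₀, hij]
    rw [Finset.sum_eq_single γ₀]
    · rw [if_pos ⟨hi, hj⟩, VectorFamily.localProb, H.norm_sq_pair hr, hi, hj]
    · intro γ _ hne
      refine if_neg fun hγ => hne (funext fun x => ?_)
      obtain ⟨x, hx⟩ := x
      rcases Finset.mem_insert.1 hx with rfl | hx'
      · rw [hi]; exact hγ.1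
      · obtain rfl := Finset.mem_singleton.1 hx'
        rw [hj]; exact hγ.2
    · simp

theorem pairProb_eq (H : IsLasserreSolution r ε E c S h L v) (hr : 2 ≤ r) (i j : Fin n)
    (a b : Bool) : v.pairProb i j a b = (1 + bitSign a * v.bias i + bitSign b * v.bias j +
      bitSign a * bitSign b * ⟪v.vec i, v.vec j⟫) / 4 := by
  rw [H.pairProb_eq_inner hr, H.single_eq hr, H.single_eq hr]
  simp only [real_inner_smul_left, real_inner_smul_right, inner_add_left, inner_add_right,
    H.inner_empty_self, H.inner_empty_vec hr, real_inner_comm v.empty (v.vec i)]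
  ring

theorem cutProb_empty (H : IsLasserreSolution r ε E c S h L v) (hr : 2 ≤ r)
    (α : (∅ : Finset (Fin n)) → Bool) (i j : Fin n) :
    v.cutProb ∅ α i j = (1 - ⟪v.vec i, v.vec j⟫) / 2 := by
  -- Generalizing over `W` avoids transporting assignments along `∅ ∪ {i, j} = {i, j}`.
  have key : ∀ (W : Finset (Fin n)) (hW : W = {i, j}) (hi : i ∈ W) (hj : j ∈ W),
      (∑ γ : W → Bool, if γ ⟨i, hi⟩ ≠ γ ⟨j, hj⟩ then ‖v W γ‖ ^ 2 else 0) =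
        v.pairProb i j true false + v.pairProb i j false true := by
    rintro W rfl hi hj
    rw [VectorFamily.pairProb, VectorFamily.pairProb, ← Finset.sum_add_distrib]
    refine Finset.sum_congr rfl fun γ _ => ?_
    cases h1 : γ ⟨i, hi⟩ <;> cases h2 : γ ⟨j, hj⟩ <;> simp [VectorFamily.localProb]
  have h1 : v.cutProb ∅ α i j = v.pairProb i j true false + v.pairProb i j false true := by
    rw [← key (∅ ∪ {i, j}) (Finset.empty_union _) (by simp) (by simp), VectorFamily.cutProb]
    refine Finset.sum_congr rfl fun γ _ => ?_
    have : Finset.restrict₂ (π := fun _ => Bool) Finset.subset_union_left γ = α :=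
      Subsingleton.elim _ _
    simp [this]
  rw [h1, H.pairProb_eq hr, H.pairProb_eq hr]
  simp [bitSign]
  ring

theorem inner_orthVec (H : IsLasserreSolution r ε E c S h L v) (hr : 2 ≤ r) (i j : Fin n) :
    ⟪v.orthVec i, v.orthVec j⟫ = ⟪v.vec i, v.vec j⟫ - v.bias i * v.bias j := by
  simp only [VectorFamily.orthVec, inner_sub_left, inner_sub_right, real_inner_smul_left,
    real_inner_smul_right, H.inner_empty_self, H.inner_empty_vec hr,
    real_inner_comm v.empty (v.vec i)]
  ring

theorem norm_sq_orthVec (H : IsLasserreSolution r ε E c S h L v) (hr : 2 ≤ r) (i : Fin n) :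
    ‖v.orthVec i‖ ^ 2 = 1 - v.bias i ^ 2 := by
  rw [← real_inner_self_eq_norm_sq, H.inner_orthVec hr, H.inner_vec_self hr]; ring

theorem bias_mem (H : IsLasserreSolution r ε E c S h L v) (hr : 2 ≤ r) (i : Fin n) :
    -1 ≤ v.bias i ∧ v.bias i ≤ 1 := by
  have := H.norm_sq_orthVec hr i
  rw [← abs_le, ← sq_le_one_iff_abs_le_one]
  nlinarith [sq_nonneg ‖v.orthVec i‖]

theorem bias_of_mem (H : IsLasserreSolution r ε E c S h L v) (hr : 2 ≤ r) (i : S) :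
    v.bias i = bitSign (h i) := by
  have h1 := H.partial_fixing ∅ (fun _ => false) (by simp; omega) i
  change ⟪v.empty, v.single i (h i)⟫ = ⟪v.empty, v.empty⟫ at h1
  rw [H.single_eq hr, real_inner_smul_right, inner_add_right, real_inner_smul_right,
    H.inner_empty_self, H.inner_empty_vec hr] at h1
  cases hi : h i <;> simp [hi, bitSign] at h1 ⊢ <;> linarith

/-- The inner product is the covariance of two `±1` variables, four times that of the corresponding
bits; hence `16`. -/
theorem sq_inner_orthVec_le (H : IsLasserreSolution r ε E c S h L v) (hr : 2 ≤ r) (i j : Fin n) :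
    ⟪v.orthVec i, v.orthVec j⟫ ^ 2 ≤ 16 * mutualInfo (v.pairProb i j) := by
  have h0 : ∀ a b, 0 ≤ v.pairProb i j a b := fun a b =>
    Finset.sum_nonneg fun γ _ => by
      split_ifs
      · exact sq_nonneg _
      · exact le_rfl
  have h1 : ∑ a, ∑ b, v.pairProb i j a b = 1 := by
    simp only [H.pairProb_eq hr, Fintype.sum_bool, bitSign]
    simp
    ring
  have h2 := sq_le_mutualInfo h0 h1
  refine le_trans (le_of_eq ?_) (mul_le_mul_of_nonneg_left h2 (by norm_num))
  rw [H.inner_orthVec hr]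
  simp only [H.pairProb_eq hr, Fintype.sum_bool, bitSign]
  simp
  ring

end IsLasserreSolution

end Lasserre

/-! ### Decoupling after a small modification of the events -/

section Approximation

set_option linter.unusedSectionVars false

variable {E : Type*} [NormedAddCommGroup E] [InnerProductSpace ℝ E] [FiniteDimensional ℝ E]
  [MeasurableSpace E] [BorelSpace E]
  {ι κ : Type*} [Fintype ι] [Fintype κ] [DecidableEq ι] [DecidableEq κ]

theorem abs_integral_bits_le_one {u : ι → E} {A : ι → Set ℝ} {f : (ι → Bool) → ℝ}
    (hf : ∀ b, f b ∈ Set.Icc (0 : ℝ) 1) :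
    |∫ x, f (bits A fun i => ⟪u i, x⟫) ∂stdGaussian E| ≤ 1 := by
  have := norm_integral_le_of_norm_le_const (μ := stdGaussian E) (C := 1)
    (f := fun x => f (bits A fun i => ⟪u i, x⟫)) (ae_of_all _ fun x => by
      rw [Real.norm_eq_abs, abs_of_nonneg (hf _).1]; exact (hf _).2)
  simpa using this

/-- Decoupling for families that are close to threshold families with small
cross-correlations. -/
theorem abs_integral_bits_mul_sub_le_of_approx {u u' : ι → E} {v v' : κ → E}
    {A A' : ι → Set ℝ} {B B' : κ → Set ℝ}
    (hA : ∀ i, MeasurableSet (A i)) (hB : ∀ j, MeasurableSet (B j))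
    (hA' : ∀ i, IsThreshold (A' i) (u' i)) (hB' : ∀ j, IsThreshold (B' j) (v' j)) {θ : ℝ}
    (hu : ∀ i, (stdGaussian E).real {x | ¬(⟪u i, x⟫ ∈ A i ↔ ⟪u' i, x⟫ ∈ A' i)} ≤ θ)
    (hv : ∀ j, (stdGaussian E).real {x | ¬(⟪v j, x⟫ ∈ B j ↔ ⟪v' j, x⟫ ∈ B' j)} ≤ θ)
    {f : (ι → Bool) → ℝ} {g : (κ → Bool) → ℝ} (hf : ∀ b, f b ∈ Set.Icc (0 : ℝ) 1)
    (hg : ∀ b, g b ∈ Set.Icc (0 : ℝ) 1) {c η : ℝ} (hc : 0 < c)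
    (hη : ∑ i, ∑ j, |⟪u' i, v' j⟫| ≤ η) :
    |(∫ x, f (bits A fun i => ⟪u i, x⟫) * g (bits B fun j => ⟪v j, x⟫) ∂stdGaussian E) -
        (∫ x, f (bits A fun i => ⟪u i, x⟫) ∂stdGaussian E) *
          ∫ x, g (bits B fun j => ⟪v j, x⟫) ∂stdGaussian E| ≤
      2 * ((Fintype.card ι + Fintype.card κ : ℝ) * (θ + 2 * c + η / c ^ 2)) := by
  have hA'm : ∀ i, MeasurableSet (A' i) := fun i => (hA' i).measurableSet
  have hB'm : ∀ i, MeasurableSet (B' i) := fun i => (hB' i).measurableSet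
  have h0 := abs_integral_bits_mul_sub_le hA' hB' hf hg hc hη
  have h1 := (abs_integral_bits_sub_le (u := u) (u' := u') hA hA'm hf).trans
    (Finset.sum_le_card_nsmul _ _ θ fun i _ => hu i)
  have h2 := (abs_integral_bits_sub_le (u := v) (u' := v') hB hB'm hg).trans
    (Finset.sum_le_card_nsmul _ _ θ fun i _ => hv i)
  let F : (ι ⊕ κ → Bool) → ℝ := fun b => f (b ∘ Sum.inl) * g (b ∘ Sum.inr)
  have hF : ∀ b, F b ∈ Set.Icc (0 : ℝ) 1 := fun b =>
    ⟨mul_nonneg (hf _).1 (hg _).1, mul_le_one₀ (hf _).2 (hg _).1 (hg _).2⟩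
  have h3 := (abs_integral_bits_sub_le (u := Sum.elim u v) (u' := Sum.elim u' v')
    (A := Sum.elim A B) (A' := Sum.elim A' B') (by rintro (i | j); exacts [hA i, hB j])
    (by rintro (i | j); exacts [hA'm i, hB'm j]) hF).trans
    (Finset.sum_le_card_nsmul _ _ θ fun k _ => by
      rcases k with i | j
      exacts [hu i, hv j])
  change |(∫ x, f (bits A fun i => ⟪u i, x⟫) * g (bits B fun j => ⟪v j, x⟫) ∂stdGaussian E) -
    ∫ x, f (bits A' fun i => ⟪u' i, x⟫) * g (bits B' fun j => ⟪v' j, x⟫) ∂stdGaussian E| ≤ _ at h3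
  have m1 := abs_integral_bits_le_one (u := u') (A := A') hf
  have m2 := abs_integral_bits_le_one (u := v) (A := B) hg
  simp only [Finset.card_univ, Fintype.card_sum, nsmul_eq_mul, Nat.cast_add] at h1 h2 h3
  generalize (∫ x, f (bits A fun i => ⟪u i, x⟫) ∂stdGaussian E) = a at *
  generalize (∫ x, f (bits A' fun i => ⟪u' i, x⟫) ∂stdGaussian E) = a' at *
  generalize (∫ x, g (bits B fun i => ⟪v i, x⟫) ∂stdGaussian E) = b at *
  generalize (∫ x, g (bits B' fun i => ⟪v' i, x⟫) ∂stdGaussian E) = b' at *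
  generalize (∫ x, f (bits A fun i => ⟪u i, x⟫) * g (bits B fun j => ⟪v j, x⟫)
    ∂stdGaussian E) = p at *
  generalize (∫ x, f (bits A' fun i => ⟪u' i, x⟫) * g (bits B' fun j => ⟪v' j, x⟫)
    ∂stdGaussian E) = p' at *
  -- The modification is paid for twice, once in the joint expectation and once in the product of
  -- expectations; this gives the coefficient `2` of `θ` in the conclusion.
  have e : p - a * b = (p - p') + (p' - a' * b') + (-(a - a') * b + -(b - b') * a') := by ring
  have t1 : |-(a - a') * b| ≤ |a - a'| := by
    rw [abs_mul, abs_neg]; exact mul_le_of_le_one_right (abs_nonneg _) m2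
  have t2 : |-(b - b') * a'| ≤ |b - b'| := by
    rw [abs_mul, abs_neg]; exact mul_le_of_le_one_right (abs_nonneg _) m1
  rw [e]
  have := abs_add_le ((p - p') + (p' - a' * b')) (-(a - a') * b + -(b - b') * a')
  have := abs_add_le (p - p') (p' - a' * b')
  have := abs_add_le (-(a - a') * b) (-(b - b') * a')
  linarith

end Approximation

/-! ### Rounding as threshold events, and the loss on a single edge -/

section Directions

variable {n d r k : ℕ} {ε : ℝ} {E : Fin k → Instance n} {c : Fin k → ℝ}
  {S : Finset (Fin n)} {h : S → Bool} {L : Finset (Fin k)} {v : VectorFamily n d}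

/-- The set of values of `⟪g, w̄_i⟫` for which the vertex `i` is rounded to `1`. -/
def roundSet (v : VectorFamily n d) (i : Fin n) : Set ℝ := quantileSet (roundProb (v.bias i))

namespace IsLasserreSolution

theorem unitVec_mem_perp (H : IsLasserreSolution r ε E c S h L v) (i : Fin n) :
    v.unitVec i ∈ v.perp := by
  refine Submodule.smul_mem _ _ ?_
  rw [Submodule.mem_orthogonal_singleton_iff_inner_right, VectorFamily.orthVec, inner_sub_right,
    real_inner_smul_right, H.inner_empty_self, mul_one, sub_self]

/-- `unitVec` as an element of the orthogonal complement of `v_∅`. -/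
def dir (H : IsLasserreSolution r ε E c S h L v) (i : Fin n) : v.perp :=
  ⟨v.unitVec i, H.unitVec_mem_perp i⟩

theorem inner_dir (H : IsLasserreSolution r ε E c S h L v) (i j : Fin n) :
    ⟪H.dir i, H.dir j⟫ = ‖v.orthVec i‖⁻¹ * ‖v.orthVec j‖⁻¹ * ⟪v.orthVec i, v.orthVec j⟫ := by
  rw [Submodule.coe_inner]
  simp only [dir, VectorFamily.unitVec, real_inner_smul_left, real_inner_smul_right]
  ring

theorem norm_dir (H : IsLasserreSolution r ε E c S h L v) (hr : 2 ≤ r) {i : Fin n}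
    (hi : 0 < 1 - v.bias i ^ 2) : ‖H.dir i‖ = 1 := by
  rw [← H.norm_sq_orthVec hr] at hi
  have h0 : ‖v.orthVec i‖ ≠ 0 := fun h0 => by simp [h0] at hi
  have : ‖H.dir i‖ ^ 2 = 1 := by
    rw [← real_inner_self_eq_norm_sq, H.inner_dir, real_inner_self_eq_norm_sq]
    field_simp
  nlinarith [norm_nonneg (H.dir i)]

theorem bias_cases (H : IsLasserreSolution r ε E c S h L v) (hr : 2 ≤ r) (i : Fin n) :
    0 < 1 - v.bias i ^ 2 ∧ -1 < v.bias i ∧ v.bias i < 1 ∨ v.bias i = 1 ∨ v.bias i = -1 := by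
  obtain ⟨h1, h2⟩ := H.bias_mem hr i
  rcases h1.eq_or_lt with h1 | h1
  · exact Or.inr (Or.inr h1.symm)
  rcases h2.eq_or_lt with h2 | h2
  · exact Or.inr (Or.inl h2)
  exact Or.inl ⟨by nlinarith, h1, h2⟩

theorem isThreshold_roundSet (H : IsLasserreSolution r ε E c S h L v) (hr : 2 ≤ r) (i : Fin n) :
    IsThreshold (roundSet v i) (H.dir i) := by
  rcases H.bias_cases hr i with ⟨h1, h2, h3⟩ | h1 | h1
  · obtain ⟨h4, h5⟩ := roundProb_mem_Ioo h2 h3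
    obtain ⟨t, ht, -⟩ := quantileSet_eq_Iic h4 h5
    exact Or.inr (Or.inr ⟨t, ht, H.norm_dir hr h1⟩)
  · exact Or.inr (Or.inl (by rw [roundSet, h1, roundProb_one, quantileSet_one]))
  · exact Or.inl (by rw [roundSet, h1, roundProb_neg_one, quantileSet_zero])

theorem measurableSet_roundSet (H : IsLasserreSolution r ε E c S h L v) (hr : 2 ≤ r)
    (i : Fin n) : MeasurableSet (roundSet v i) :=
  (H.isThreshold_roundSet hr i).measurableSet

theorem measureReal_dir_mem_roundSet (H : IsLasserreSolution r ε E c S h L v) (hr : 2 ≤ r)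
    (i : Fin n) :
    (stdGaussian v.perp).real {g | ⟪H.dir i, g⟫ ∈ roundSet v i} = roundProb (v.bias i) := by
  rcases H.bias_cases hr i with ⟨h1, h2, h3⟩ | h1 | h1
  · rw [measureReal_inner_mem_of_norm_eq_one (H.norm_dir hr h1) (H.measurableSet_roundSet hr i)]
    obtain ⟨h4, h5⟩ := roundProb_mem_Ioo h2 h3
    obtain ⟨t, ht, ht'⟩ := quantileSet_eq_Iic h4 h5
    rw [roundSet, ht, ht']
  · simp [roundSet, h1, roundProb_one, quantileSet_one]
  · simp [roundSet, h1, roundProb_neg_one, quantileSet_zero]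

open Classical in
-- Vertices of `S` need no separate treatment: partial fixing forces their bias to be `±1`, whose
-- acceptance set is everything or empty, so the threshold rule reproduces `h`.
theorem assignment_eq (H : IsLasserreSolution r ε E c S h L v) (hr : 2 ≤ r) (g : v.perp)
    (i : Fin n) : v.assignment h g i = decide (⟪H.dir i, g⟫ ∈ roundSet v i) := by
  have hin : ⟪(g : EuclideanSpace ℝ (Fin d)), v.unitVec i⟫ = ⟪H.dir i, g⟫ := by
    rw [real_inner_comm, Submodule.coe_inner]; rfl
  by_cases hi : i ∈ S
  · have hb := H.bias_of_mem hr ⟨i, hi⟩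
    rw [VectorFamily.assignment, dif_pos hi]
    cases hh : h ⟨i, hi⟩
    · have : v.bias i = -1 := by simpa [hh, bitSign] using hb
      simp [roundSet, this, roundProb_neg_one, quantileSet_zero]
    · have : v.bias i = 1 := by simpa [hh, bitSign] using hb
      simp [roundSet, this, roundProb_one, quantileSet_one]
  · rw [VectorFamily.assignment, dif_neg hi, VectorFamily.rounded, hin]
    by_cases hm : ⟪H.dir i, g⟫ ∈ roundSet v i
    · rw [decide_eq_true hm]; exact if_pos hm
    · rw [decide_eq_false hm]; exact if_neg hm

/-! ### The probability that an edge is cut -/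

/-- The event that the endpoints `i` and `j` are separated. -/
def sepEvent (H : IsLasserreSolution r ε E c S h L v) (i j : Fin n) : Set v.perp :=
  {g | ¬(⟪H.dir i, g⟫ ∈ roundSet v i ↔ ⟪H.dir j, g⟫ ∈ roundSet v j)}

open scoped symmDiff in
theorem sepEvent_eq_symmDiff (H : IsLasserreSolution r ε E c S h L v) (i j : Fin n) :
    H.sepEvent i j = {g | ⟪H.dir i, g⟫ ∈ roundSet v i} ∆ {g | ⟪H.dir j, g⟫ ∈ roundSet v j} := by
  ext g
  simp only [sepEvent, Set.mem_ofPred_eq, Set.mem_symmDiff]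
  tauto

theorem abs_bias_sub_le (H : IsLasserreSolution r ε E c S h L v) (hr : 2 ≤ r) (i j : Fin n) :
    0.395 * |v.bias i - v.bias j| ≤ (stdGaussian v.perp).real (H.sepEvent i j) := by
  refine (abs_sub_le_abs_roundProb_sub _ _).trans ?_
  rw [← H.measureReal_dir_mem_roundSet hr, ← H.measureReal_dir_mem_roundSet hr,
    sepEvent_eq_symmDiff]
  exact abs_measureReal_sub_le_measureReal_symmDiff _ _ _

theorem sepEvent_comm (H : IsLasserreSolution r ε E c S h L v) (i j : Fin n) :
    H.sepEvent i j = H.sepEvent j i := by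
  rw [sepEvent_eq_symmDiff, sepEvent_eq_symmDiff, symmDiff_comm]

theorem one_sub_inner_dir_mul_le (H : IsLasserreSolution r ε E c S h L v) (hr : 2 ≤ r)
    {i j : Fin n} (hi : 0 < 1 - v.bias i ^ 2) (hj : 0 < 1 - v.bias j ^ 2) :
    (1 - ⟪H.dir i, H.dir j⟫) / 2 * (0.19 * (1 - v.bias i ^ 2)) ≤
      2 * (stdGaussian v.perp).real (H.sepEvent i j) := by
  have key : ∀ i, 0 < 1 - v.bias i ^ 2 → ∃ t, roundSet v i = Set.Iic t ∧
      (gaussianReal 0 1).real (Set.Iic t) = roundProb (v.bias i) := fun i hi => by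
    obtain ⟨h4, h5⟩ := roundProb_mem_Ioo (μ := v.bias i) (by nlinarith) (by nlinarith)
    exact quantileSet_eq_Iic h4 h5
  obtain ⟨s, hs, hs'⟩ := key i hi
  obtain ⟨t, ht, -⟩ := key j hj
  have hb := H.bias_mem hr i
  have hρ := real_inner_le_norm (H.dir i) (H.dir j)
  rw [H.norm_dir hr hi, H.norm_dir hr hj] at hρ
  refine (mul_le_mul_of_nonneg_left (mul_le_min_roundProb hb.1 hb.2) (by linarith)).trans ?_
  have := mul_min_le_measureReal_symmDiff (H.norm_dir hr hi) (H.norm_dir hr hj) s t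
  rw [hs'] at this
  rw [sepEvent_eq_symmDiff, hs, ht]
  exact this

/-- With biases `μ`, `ν`, lengths `s`, `t` of the orthogonal parts and correlation `ρ` of the
directions, `1 - ⟪v_i, v_j⟫ = (1 - μ * ν - s * t) + (1 - ρ) * (s * t)`. The first term is at most
`|μ - ν|`, so at most `D / 0.395`. The second is at most `4 * D / 0.19`, by averaging the half-space
bound based at `i` and at `j`. The sum is below `24 * D`. -/
theorem cutProb_le_measureReal_sepEvent (H : IsLasserreSolution r ε E c S h L v) (hr : 2 ≤ r)
    (i j : Fin n) :
    (1 - ⟪v.vec i, v.vec j⟫) / 2 ≤ 12 * (stdGaussian v.perp).real (H.sepEvent i j) := by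
  have hD := H.abs_bias_sub_le hr i j
  have hi := H.norm_sq_orthVec hr i
  have hj := H.norm_sq_orthVec hr j
  have hbi := H.bias_mem hr i
  have hbj := H.bias_mem hr j
  have hin := H.inner_orthVec hr i j
  have hdir := H.inner_dir i j
  have hcs := abs_real_inner_le_norm (v.orthVec i) (v.orthVec j)
  have hsep : 0 < 1 - v.bias i ^ 2 → 0 < 1 - v.bias j ^ 2 → _ :=
    fun a b => H.one_sub_inner_dir_mul_le hr a b
  have hsep' : 0 < 1 - v.bias i ^ 2 → 0 < 1 - v.bias j ^ 2 → _ :=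
    fun a b => H.one_sub_inner_dir_mul_le hr b a
  rw [H.sepEvent_comm j i, real_inner_comm] at hsep'
  have hρ1 : 0 < 1 - v.bias i ^ 2 → 0 < 1 - v.bias j ^ 2 → ⟪H.dir i, H.dir j⟫ ≤ 1 := fun a b => by
    have := real_inner_le_norm (H.dir i) (H.dir j)
    rwa [H.norm_dir hr a, H.norm_dir hr b, one_mul] at this
  generalize (stdGaussian v.perp).real (H.sepEvent i j) = D at *
  generalize ⟪H.dir i, H.dir j⟫ = ρ at *
  have hs0 := norm_nonneg (v.orthVec i)
  have ht0 := norm_nonneg (v.orthVec j)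
  generalize ‖v.orthVec i‖ = s at *
  generalize ‖v.orthVec j‖ = t at *
  generalize ⟪v.orthVec i, v.orthVec j⟫ = w at *
  generalize ⟪v.vec i, v.vec j⟫ = τ at *
  generalize v.bias i = μ at *
  generalize v.bias j = ν at *
  have hfirst : 1 - μ * ν - s * t ≤ |μ - ν| := by
    have hst : (s * t) ^ 2 = (1 - μ ^ 2) * (1 - ν ^ 2) := by rw [mul_pow, hi, hj]
    have hst0 : 0 ≤ s * t := mul_nonneg hs0 ht0
    -- This suffices because `1 - x * y - (1 - x) * (1 + y) = x - y`.
    have aux : ∀ x y : ℝ, -1 ≤ x → x ≤ 1 → -1 ≤ y → y ≤ 1 → y ≤ x →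
        (s * t) ^ 2 = (1 - x ^ 2) * (1 - y ^ 2) → (1 - x) * (1 + y) ≤ s * t := by
      intro x y hx hx' hy hy' hyx he
      have h1 : 0 ≤ (1 - x) * (1 + y) := mul_nonneg (by linarith) (by linarith)
      refine abs_le_of_sq_le_sq' ?_ hst0 |>.2
      rw [he]
      nlinarith
    rcases le_total ν μ with h | h
    · have := aux μ ν hbi.1 hbi.2 hbj.1 hbj.2 h hst
      rw [abs_of_nonneg (sub_nonneg.2 h)]
      nlinarith
    · have := aux ν μ hbj.1 hbj.2 hbi.1 hbi.2 h (by rw [hst]; ring)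
      rw [abs_of_nonpos (sub_nonpos.2 h)]
      nlinarith
  have hD0 : 0 ≤ D := le_trans (by positivity) hD
  -- If `s` or `t` vanishes there is no direction to compare, but then the second term is absent.
  rcases hs0.eq_or_lt with hs | hs
  · rw [← hs, zero_mul] at hcs hfirst
    have hw := abs_nonpos_iff.1 hcs
    linarith
  rcases ht0.eq_or_lt with ht | ht
  · rw [← ht, mul_zero] at hcs hfirst
    have hw := abs_nonpos_iff.1 hcs
    linarith
  have hw : w = ρ * (s * t) := by
    rw [hdir]; field_simp
  have hpi : 0 < 1 - μ ^ 2 := by rw [← hi]; positivity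
  have hpj : 0 < 1 - ν ^ 2 := by rw [← hj]; positivity
  have a1 := hsep hpi hpj
  have a2 := hsep' hpi hpj
  have a3 := hρ1 hpi hpj
  rw [← hi] at a1
  rw [← hj] at a2
  have a4 : (1 - ρ) * (s * t) ≤ (1 - ρ) * ((s ^ 2 + t ^ 2) / 2) :=
    mul_le_mul_of_nonneg_left (by nlinarith [sq_nonneg (s - t)]) (by linarith)
  have e : 1 - τ = (1 - μ * ν - s * t) + (1 - ρ) * (s * t) := by
    have : τ = w + μ * ν := by linarith
    rw [this, hw]; ring
  rw [e]
  linarith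

end IsLasserreSolution

end Directions

/-! ### Mean and variance of the active cut weight -/

section Variance

variable {n d r k : ℕ} {ε δ : ℝ} {E : Fin k → Instance n} {c : Fin k → ℝ}
  {S : Finset (Fin n)} {h : S → Bool} {L : Finset (Fin k)} {v : VectorFamily n d}

/-- The endpoints of an edge. -/
def ends (e : Fin n × Fin n) : Fin 2 → Fin n := ![e.1, e.2]

/-- The indicator that two bits differ. -/
def cutBit (b : Fin 2 → Bool) : ℝ := if b 0 ≠ b 1 then 1 else 0

theorem cutBit_mem (b : Fin 2 → Bool) : cutBit b ∈ Set.Icc (0 : ℝ) 1 := by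
  unfold cutBit
  split_ifs <;> simp

theorem weight_nonneg_of_mem_active (I : Instance n) {e : Fin n × Fin n} (he : e ∈ active S) :
    0 ≤ I.weight e :=
  I.nonneg e (Finset.mem_of_mem_filter e he)

theorem activeWeight_nonneg (I : Instance n) : 0 ≤ activeWeight S I :=
  Finset.sum_nonneg fun _ he => weight_nonneg_of_mem_active I he

theorem activeWeight_le_actdeg (I : Instance n) : activeWeight S I ≤ actdeg S I := by
  unfold actdeg actdegVertex activeWeight
  simp only [Finset.sum_filter (s := active S)]
  rw [Finset.sum_comm]
  refine Finset.sum_le_sum fun e he => ?_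
  have hnn : ∀ x, 0 ≤ if e.1 = x ∨ e.2 = x then I.weight e else 0 := fun x => by
    split_ifs
    · exact weight_nonneg_of_mem_active I he
    · exact le_rfl
  rcases (Finset.mem_filter.1 he).2 with h1 | h1
  · refine le_trans (le_of_eq ?_) (Finset.single_le_sum (fun x _ => hnn x)
      (Finset.mem_compl.2 h1))
    simp
  · refine le_trans (le_of_eq ?_) (Finset.single_le_sum (fun x _ => hnn x)
      (Finset.mem_compl.2 h1))
    simp

theorem sum_weight_mul_edgeInfo_le {l : Fin k} (hI : IsIndependent δ E S L v) (hl : l ∈ L) :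
    ∑ a ∈ active S, ∑ b ∈ active S, (E l).weight a * (E l).weight b * edgeInfo v a b ≤
      activeWeight S (E l) ^ 2 * δ := by
  have hle := mul_le_mul_of_nonneg_left (hI l hl) (sq_nonneg (activeWeight S (E l)))
  refine le_trans (le_of_eq ?_) hle
  rw [Finset.mul_sum]
  refine Finset.sum_congr rfl fun a ha => ?_
  rw [Finset.mul_sum]
  refine Finset.sum_congr rfl fun b hb => ?_
  rw [actdist, if_pos ha, actdist, if_pos hb]
  -- With zero active weight the division in `actdist` is by zero, but then every active edge has
  -- weight zero.
  rcases (activeWeight_nonneg (S := S) (E l)).eq_or_lt with h0 | h0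
  · have hz : (E l).weight a = 0 :=
      (Finset.sum_eq_zero_iff_of_nonneg fun e he => weight_nonneg_of_mem_active (E l) he).1
        h0.symm a ha
    simp [hz]
  · field_simp

namespace IsLasserreSolution

/-- The indicator that the edge `e` is cut. -/
def edgeCut (H : IsLasserreSolution r ε E c S h L v) (e : Fin n × Fin n) (g : v.perp) : ℝ :=
  cutBit (bits (fun i => roundSet v (ends e i)) fun i => ⟪H.dir (ends e i), g⟫)

theorem edgeCut_mem (H : IsLasserreSolution r ε E c S h L v) (e : Fin n × Fin n) (g : v.perp) :
    H.edgeCut e g ∈ Set.Icc (0 : ℝ) 1 :=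
  cutBit_mem _

theorem measurable_edgeCut (H : IsLasserreSolution r ε E c S h L v) (hr : 2 ≤ r)
    (e : Fin n × Fin n) : Measurable (H.edgeCut e) :=
  ((measurable_of_finite cutBit).comp
    (measurable_bits fun _ => H.measurableSet_roundSet hr _)).comp
    (g := cutBit ∘ bits (fun i => roundSet v (ends e i))) (by fun_prop)

theorem cutWeight_eq (H : IsLasserreSolution r ε E c S h L v) (hr : 2 ≤ r) (I : Instance n) :
    v.cutWeight I h = fun g => ∑ e ∈ active S, I.weight e * H.edgeCut e g := by
  ext g
  refine Finset.sum_congr rfl fun e _ => ?_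
  rw [H.assignment_eq hr, H.assignment_eq hr]
  rfl

theorem integral_edgeCut (H : IsLasserreSolution r ε E c S h L v) (hr : 2 ≤ r)
    (e : Fin n × Fin n) :
    ∫ g, H.edgeCut e g ∂stdGaussian v.perp =
      (stdGaussian v.perp).real (H.sepEvent e.1 e.2) := by
  have hm : MeasurableSet (H.sepEvent e.1 e.2) := by
    have a : ∀ i, MeasurableSet {g | ⟪H.dir i, g⟫ ∈ roundSet v i} := fun i =>
      (show Measurable fun g => ⟪H.dir i, g⟫ by fun_prop) (H.measurableSet_roundSet hr i)
    exact MeasurableSet.compl (MeasurableSet.iff (a e.1) (a e.2))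
  rw [← integral_indicator_one hm]
  congr 1
  ext g
  by_cases h1 : ⟪H.dir e.1, g⟫ ∈ roundSet v e.1 <;>
    by_cases h2 : ⟪H.dir e.2, g⟫ ∈ roundSet v e.2 <;>
    simp [edgeCut, cutBit, bits, ends, sepEvent, Set.indicator, h1, h2, -Submodule.coe_inner]

theorem integrable_edgeCut (H : IsLasserreSolution r ε E c S h L v) (hr : 2 ≤ r)
    (e : Fin n × Fin n) : Integrable (H.edgeCut e) (stdGaussian v.perp) :=
  Integrable.of_bound (H.measurable_edgeCut hr e).aestronglyMeasurable 1 (ae_of_all _ fun g => by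
    rw [Real.norm_eq_abs, abs_of_nonneg (H.edgeCut_mem e g).1]; exact (H.edgeCut_mem e g).2)

theorem integrable_edgeCut_mul (H : IsLasserreSolution r ε E c S h L v) (hr : 2 ≤ r)
    (e f : Fin n × Fin n) :
    Integrable (fun g => H.edgeCut e g * H.edgeCut f g) (stdGaussian v.perp) :=
  Integrable.of_bound ((H.measurable_edgeCut hr e).mul
    (H.measurable_edgeCut hr f)).aestronglyMeasurable 1 (ae_of_all _ fun g => by
    have he := H.edgeCut_mem e g
    have hf := H.edgeCut_mem f g
    rw [Real.norm_eq_abs, abs_of_nonneg (mul_nonneg he.1 hf.1)]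
    exact mul_le_one₀ he.2 hf.1 hf.2)

theorem activeWeight_le_integral (H : IsLasserreSolution r ε E c S h L v) (hr : 2 ≤ r)
    (hε : 0 < ε) {l : Fin k} (hl : l ∈ L) :
    ε * activeWeight S (E l) ≤ 36 * ∫ g, v.cutWeight (E l) h g ∂v.gaussianLaw := by
  have h1 := H.active_cut ∅ (fun _ => false) (by simpa using hr) l hl
  have h2 : ‖v ∅ (fun _ => false)‖ ^ 2 = 1 := H.norm_empty
  rw [h2, mul_one] at h1
  have h3 : ∫ g, v.cutWeight (E l) h g ∂v.gaussianLaw = ∑ e ∈ active S,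
      (E l).weight e * (stdGaussian v.perp).real (H.sepEvent e.1 e.2) := by
    rw [H.cutWeight_eq hr, VectorFamily.gaussianLaw,
      integral_finsetSum _ fun e _ => (H.integrable_edgeCut hr e).const_mul _]
    exact Finset.sum_congr rfl fun e _ => by rw [integral_const_mul, H.integral_edgeCut hr]
  have h4 : ∑ e ∈ active S, (E l).weight e * v.cutProb ∅ (fun _ => false) e.1 e.2 ≤
      12 * ∑ e ∈ active S, (E l).weight e * (stdGaussian v.perp).real (H.sepEvent e.1 e.2) := by
    rw [Finset.mul_sum]
    refine Finset.sum_le_sum fun e he => ?_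
    rw [H.cutProb_empty hr]
    have := mul_le_mul_of_nonneg_left (H.cutProb_le_measureReal_sepEvent hr e.1 e.2)
      (weight_nonneg_of_mem_active (E l) he)
    linarith
  have h5 := mul_le_mul_of_nonneg_left (activeWeight_le_actdeg (S := S) (E l)) hε.le
  rw [h3]
  linarith

/-! ### Truncation of nearly deterministic vertices -/

open Classical in
/-- `roundSet`, with nearly deterministic vertices made deterministic. -/
def truncSet (v : VectorFamily n d) (θ : ℝ) (i : Fin n) : Set ℝ :=
  if θ < 1 - v.bias i ^ 2 then roundSet v i
  else if 1 / 2 ≤ roundProb (v.bias i) then Set.univ else ∅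

open Classical in
/-- `dir`, set to zero for nearly deterministic vertices. -/
def truncDir (H : IsLasserreSolution r ε E c S h L v) (θ : ℝ) (i : Fin n) : v.perp :=
  if θ < 1 - v.bias i ^ 2 then H.dir i else 0

theorem isThreshold_truncSet (H : IsLasserreSolution r ε E c S h L v) (hr : 2 ≤ r) (θ : ℝ)
    (i : Fin n) : IsThreshold (truncSet v θ i) (H.truncDir θ i) := by
  unfold truncSet truncDir
  split_ifs
  · exact H.isThreshold_roundSet hr i
  · exact Or.inr (Or.inl rfl)
  · exact Or.inl rfl

/-- A truncated vertex takes its more likely value, and its less likely one has probability at most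
`1 - μ ^ 2 ≤ θ` by `min_roundProb_le`. -/
theorem measureReal_trunc_disagree_le (H : IsLasserreSolution r ε E c S h L v) (hr : 2 ≤ r)
    {θ : ℝ} (hθ : 0 < θ) (i : Fin n) :
    (stdGaussian v.perp).real
      {g | ¬(⟪H.dir i, g⟫ ∈ roundSet v i ↔ ⟪H.truncDir θ i, g⟫ ∈ truncSet v θ i)} ≤ θ := by
  have hb := H.bias_mem hr i
  have hmin := min_roundProb_le hb.1 hb.2
  have hp := H.measureReal_dir_mem_roundSet hr i
  unfold truncSet truncDir
  split_ifs with h1 h2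
  · simpa using hθ.le
  · simp only [Set.mem_univ, iff_true]
    have hm : MeasurableSet {g | ⟪H.dir i, g⟫ ∈ roundSet v i} :=
      (show Measurable fun g => ⟪H.dir i, g⟫ by fun_prop) (H.measurableSet_roundSet hr i)
    have := probReal_compl_eq_one_sub (μ := stdGaussian v.perp) hm
    rw [hp] at this
    rw [min_eq_right (by linarith)] at hmin
    refine (le_of_eq this).trans ?_
    linarith
  · simp only [Set.mem_empty_iff_false, iff_false, not_not]
    rw [hp]
    rw [min_eq_left (by linarith)] at hmin
    linarith

/-- Truncation pays off here: both surviving vectors have squared norm above `θ`, so normalization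
costs at most a factor `1 / θ`. -/
theorem abs_inner_truncDir_le (H : IsLasserreSolution r ε E c S h L v) (hr : 2 ≤ r)
    {θ : ℝ} (hθ : 0 < θ) (i j : Fin n) :
    |⟪H.truncDir θ i, H.truncDir θ j⟫| ≤ |⟪v.orthVec i, v.orthVec j⟫| / θ := by
  have h0 : 0 ≤ |⟪v.orthVec i, v.orthVec j⟫| / θ := by positivity
  unfold truncDir
  split_ifs with hi hj hj
  · rw [H.inner_dir, abs_mul, ← mul_inv, abs_inv, mul_comm, ← div_eq_mul_inv]
    refine div_le_div_of_nonneg_left (abs_nonneg _) hθ ?_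
    rw [← H.norm_sq_orthVec hr] at hi hj
    rw [abs_of_nonneg (by positivity)]
    have : θ ^ 2 ≤ (‖v.orthVec i‖ * ‖v.orthVec j‖) ^ 2 := by
      rw [mul_pow, pow_two θ]
      exact mul_le_mul hi.le hj.le hθ.le (by positivity)
    exact (abs_le_of_sq_le_sq' this (by positivity)).2
  · simpa using h0
  · simpa using h0
  · simpa using h0

/-- The arithmetic-geometric mean inequality replaces the square root of the information by a bound
linear in it, which can be averaged over pairs of edges. -/
theorem abs_inner_orthVec_le (H : IsLasserreSolution r ε E c S h L v) (hr : 2 ≤ r)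
    {τ : ℝ} (hτ : 0 < τ) (i j : Fin n) :
    |⟪v.orthVec i, v.orthVec j⟫| ≤ 2 * mutualInfo (v.pairProb i j) / τ + 2 * τ := by
  have h1 := H.sq_inner_orthVec_le hr i j
  rw [← sq_abs] at h1
  rw [← sub_le_iff_le_add, le_div_iff₀ hτ]
  nlinarith [sq_nonneg (|⟪v.orthVec i, v.orthVec j⟫| - 4 * τ)]

theorem abs_cov_edgeCut_le (H : IsLasserreSolution r ε E c S h L v) (hr : 2 ≤ r)
    {x : ℝ} (hx : 0 < x) (a b : Fin n × Fin n) :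
    |(∫ g, H.edgeCut a g * H.edgeCut b g ∂stdGaussian v.perp) -
        (∫ g, H.edgeCut a g ∂stdGaussian v.perp) * ∫ g, H.edgeCut b g ∂stdGaussian v.perp| ≤
      88 * x + 16 / x ^ 7 * edgeInfo v a b := by
  have key := abs_integral_bits_mul_sub_le_of_approx
    (u := fun i => H.dir (ends a i)) (u' := fun i => H.truncDir x (ends a i))
    (v := fun i => H.dir (ends b i)) (v' := fun i => H.truncDir x (ends b i))
    (A := fun i => roundSet v (ends a i)) (A' := fun i => truncSet v x (ends a i))
    (B := fun i => roundSet v (ends b i)) (B' := fun i => truncSet v x (ends b i))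
    (fun _ => H.measurableSet_roundSet hr _) (fun _ => H.measurableSet_roundSet hr _)
    (fun _ => H.isThreshold_truncSet hr x _) (fun _ => H.isThreshold_truncSet hr x _)
    (fun _ => H.measureReal_trunc_disagree_le hr hx _)
    (fun _ => H.measureReal_trunc_disagree_le hr hx _) cutBit_mem cutBit_mem hx
    -- With `θ = c = x` and `τ = x ^ 4`, the information-free part of `η / c ^ 2` is `8 * x`, of the
    -- same order as `θ + 2 * c = 3 * x`. Multiplying by `2 * 4` gives `88 * x` and the coefficient
    -- `16 / x ^ 7`.
    (η := (2 * edgeInfo v a b / x ^ 4 + 8 * x ^ 4) / x) (by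
      have hij : ∀ i j, |⟪H.truncDir x i, H.truncDir x j⟫| ≤
          (2 * mutualInfo (v.pairProb i j) / x ^ 4 + 2 * x ^ 4) / x := fun i j =>
        (H.abs_inner_truncDir_le hr hx i j).trans
          (div_le_div_of_nonneg_right (H.abs_inner_orthVec_le hr (by positivity) i j) hx.le)
      refine (Finset.sum_le_sum fun i _ => Finset.sum_le_sum fun j _ => hij _ _).trans
        (le_of_eq ?_)
      simp only [Fin.sum_univ_two, ends, edgeInfo, Matrix.cons_val_zero, Matrix.cons_val_one]
      ring)
  refine key.trans (le_of_eq ?_)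
  simp only [Fintype.card_fin]
  field_simp
  ring

theorem variance_cutWeight_le (H : IsLasserreSolution r ε E c S h L v)
    (hI : IsIndependent δ E S L v) (hr : 2 ≤ r) {l : Fin k} (hl : l ∈ L) {x : ℝ} (hx : 0 < x)
    (hδ : δ ≤ x ^ 8) :
    Var[v.cutWeight (E l) h; v.gaussianLaw] ≤ 104 * x * activeWeight S (E l) ^ 2 := by
  set w := (E l).weight with hw
  have hw0 : ∀ e ∈ active S, 0 ≤ w e := fun e he => weight_nonneg_of_mem_active (E l) he
  have hmeas : Measurable (v.cutWeight (E l) h) := by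
    rw [H.cutWeight_eq hr]
    exact Finset.measurable_sum _ fun e _ => (H.measurable_edgeCut hr e).const_mul _
  have hsq : ∀ g, v.cutWeight (E l) h g ^ 2 = ∑ a ∈ active S, ∑ b ∈ active S,
      w a * w b * (H.edgeCut a g * H.edgeCut b g) := fun g => by
    rw [H.cutWeight_eq hr, pow_two, Finset.sum_mul_sum]
    exact Finset.sum_congr rfl fun a _ => Finset.sum_congr rfl fun b _ => by ring
  have hint : ∀ a ∈ active S, Integrable (fun g => ∑ b ∈ active S,
      w a * w b * (H.edgeCut a g * H.edgeCut b g)) (stdGaussian v.perp) := fun a _ =>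
    integrable_finsetSum _ fun b _ => (H.integrable_edgeCut_mul hr a b).const_mul _
  have hmem : MemLp (v.cutWeight (E l) h) 2 (stdGaussian v.perp) := by
    rw [memLp_two_iff_integrable_sq hmeas.aestronglyMeasurable]
    simp only [hsq]
    exact integrable_finsetSum _ hint
  have hvar : Var[v.cutWeight (E l) h; v.gaussianLaw] = ∑ a ∈ active S, ∑ b ∈ active S,
      w a * w b * ((∫ g, H.edgeCut a g * H.edgeCut b g ∂stdGaussian v.perp) -
        (∫ g, H.edgeCut a g ∂stdGaussian v.perp) * ∫ g, H.edgeCut b g ∂stdGaussian v.perp) := by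
    rw [VectorFamily.gaussianLaw, variance_eq_sub hmem]
    have e1 : ∫ g, (v.cutWeight (E l) h ^ 2) g ∂stdGaussian v.perp = ∑ a ∈ active S,
        ∑ b ∈ active S, w a * w b *
          ∫ g, H.edgeCut a g * H.edgeCut b g ∂stdGaussian v.perp := by
      simp only [Pi.pow_apply, hsq]
      rw [integral_finsetSum _ hint]
      refine Finset.sum_congr rfl fun a _ => ?_
      rw [integral_finsetSum _ fun b _ => (H.integrable_edgeCut_mul hr a b).const_mul _]
      exact Finset.sum_congr rfl fun b _ => integral_const_mul _ _
    have e2 : ∫ g, v.cutWeight (E l) h g ∂stdGaussian v.perp =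
        ∑ a ∈ active S, w a * ∫ g, H.edgeCut a g ∂stdGaussian v.perp := by
      rw [H.cutWeight_eq hr,
        integral_finsetSum _ fun e _ => (H.integrable_edgeCut hr e).const_mul _]
      exact Finset.sum_congr rfl fun e _ => integral_const_mul _ _
    rw [e1, e2, pow_two, Finset.sum_mul_sum, ← Finset.sum_sub_distrib]
    refine Finset.sum_congr rfl fun a _ => ?_
    rw [← Finset.sum_sub_distrib]
    exact Finset.sum_congr rfl fun b _ => by ring
  rw [hvar]
  have hsum : ∑ a ∈ active S, ∑ b ∈ active S, w a * w b = activeWeight S (E l) ^ 2 := by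
    rw [pow_two, activeWeight, Finset.sum_mul_sum]
  calc _ ≤ ∑ a ∈ active S, ∑ b ∈ active S,
        w a * w b * (88 * x + 16 / x ^ 7 * edgeInfo v a b) :=
        Finset.sum_le_sum fun a ha => Finset.sum_le_sum fun b hb =>
          mul_le_mul_of_nonneg_left ((le_abs_self _).trans (H.abs_cov_edgeCut_le hr hx a b))
            (mul_nonneg (hw0 a ha) (hw0 b hb))
    _ = 88 * x * activeWeight S (E l) ^ 2 + 16 / x ^ 7 *
        ∑ a ∈ active S, ∑ b ∈ active S, w a * w b * edgeInfo v a b := by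
        rw [← hsum, Finset.mul_sum, Finset.mul_sum, ← Finset.sum_add_distrib]
        refine Finset.sum_congr rfl fun a _ => ?_
        rw [Finset.mul_sum, Finset.mul_sum, ← Finset.sum_add_distrib]
        exact Finset.sum_congr rfl fun b _ => by ring
    _ ≤ 88 * x * activeWeight S (E l) ^ 2 + 16 / x ^ 7 *
        (activeWeight S (E l) ^ 2 * x ^ 8) := by
        gcongr
        exact (sum_weight_mul_edgeInfo_le hI hl).trans
          (mul_le_mul_of_nonneg_left hδ (sq_nonneg _))
    _ = 104 * x * activeWeight S (E l) ^ 2 := by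
        field_simp
        ring

end IsLasserreSolution

end Variance

end SimMaxCut

end

/-! ### Choice of the function and conclusion -/

theorem SimMaxCut.isPolyLTOne_const_mul_rpow (C : ℝ) {a : ℝ} (h0 : 0 < a) (h1 : a < 1) :
    SimMaxCut.IsPolyLTOne fun x => C * x ^ a := by
  refine ⟨⟨1, fun _ => C, fun _ => a, fun _ => ⟨h0, h1⟩, fun x _ => by simp⟩, ?_⟩
  have h := ((Real.continuousAt_rpow_const 0 a (Or.inr h0.le)).tendsto.const_mul C)
  rw [Real.zero_rpow h0.ne', mul_zero] at h
  exact h.mono_left nhdsWithin_le_nhds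

theorem mainTheorem5 :
    ∃ p : ℝ → ℝ, SimMaxCut.IsPolyLTOne p ∧
      ∀ (n k d r : ℕ) (ε δ : ℝ), 2 ≤ r → 0 < ε → ε ≤ 1 / 5 → 0 ≤ δ →
      ∀ (E : Fin k → SimMaxCut.Instance n) (c : Fin k → ℝ)
        (S : Finset (Fin n)) (h : S → Bool) (L : Finset (Fin k))
        (v : SimMaxCut.VectorFamily n d),
        SimMaxCut.IsLasserreSolution r ε E c S h L v →
        SimMaxCut.IsIndependent δ E S L v →
        ∀ l ∈ L,
          ProbabilityTheory.variance (v.cutWeight (E l) h) v.gaussianLaw ≤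
            p δ / ε ^ 2 * (∫ g, v.cutWeight (E l) h g ∂v.gaussianLaw) ^ 2 := by
  -- The constant is `104 * 36 ^ 2`, combining the variance bound with the square of the mean bound.
  refine ⟨fun x => 134784 * x ^ (1 / 8 : ℝ),
    SimMaxCut.isPolyLTOne_const_mul_rpow _ (by norm_num) (by norm_num), ?_⟩
  intro n k d r ε δ hr hε _ hδ E c S h L v H hI l hl
  beta_reduce
  have hW := H.activeWeight_le_integral hr hε hl
  have hW0 := SimMaxCut.activeWeight_nonneg (S := S) (E l)
  have hV := fun x hx hδx => H.variance_cutWeight_le hI hr hl (x := x) hx hδx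
  set W := SimMaxCut.activeWeight S (E l)
  set Y := ∫ g, v.cutWeight (E l) h g ∂v.gaussianLaw
  -- The variance bound requires `x > 0`, so for `δ = 0` it is used for all `x` and `x` tends to
  -- `0`.
  rcases hδ.eq_or_lt with rfl | hδ
  · rw [Real.zero_rpow (by norm_num), mul_zero, zero_div, zero_mul]
    have ht : Tendsto (fun x : ℝ => 104 * x * W ^ 2) (𝓝[>] 0) (𝓝 0) := by
      have : Continuous fun x : ℝ => 104 * x * W ^ 2 := by fun_prop
      simpa using (this.tendsto 0).mono_left nhdsWithin_le_nhds
    refine ge_of_tendsto ht ?_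
    filter_upwards [self_mem_nhdsWithin] with x hx
    exact hV x hx (by positivity)
  · have hx : 0 < δ ^ (1 / 8 : ℝ) := by positivity
    refine (hV _ hx (le_of_eq ?_)).trans ?_
    · rw [← Real.rpow_natCast, ← Real.rpow_mul hδ.le]; norm_num
    · have h2 : W ^ 2 ≤ 1296 * Y ^ 2 / ε ^ 2 := by
        rw [le_div_iff₀ (by positivity)]
        have := pow_le_pow_left₀ (mul_nonneg hε.le hW0) hW 2
        linarith
      calc _ ≤ 104 * δ ^ (1 / 8 : ℝ) * (1296 * Y ^ 2 / ε ^ 2) := by gcongr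
        _ = _ := by ring
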